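/- Let $$\mathcal P_1=\Big\{(a,b)\in\mathbb R^2:\tfrac{a^2}{8}+\big(b-\tfrac14\big)^2\le\tfrac1{16}\Big\},\qquad \mathcal P_2=\Big\{(a,b)\in\mathbb R^2:\tfrac{a^2}{8}+\big(b-\tfrac14\big)^2\ge\tfrac1{16},\ |a|-\tfrac12\le b\le\tfrac16\Big\},$$ and $\mathcal P=\mathcal P_1\cup\mathcal P_2$. Let $(a,b)\in\mathcal P$, and let $(\xi_k)_{k\in\mathbb Z}$ be a stationary, centered, circularly symmetric complex Gaussian process with $\mathbb E[\xi_k\overline{\xi_l}]=\gamma(l-k)$, where $\gamma(0)=1$, $\gamma(\pm1)=a$, $\gamma(\pm2)=b$ and $\gamma(k)=0$ for $|k|\ge3$. Put $f_{a,b}(z)=\sum_{k=0}^\infty\xi_kz^k$, and for $0<r<1$ let $N(r)=\#\{z\in\mathbb C: |z|<r,\ f_{a,b}(z)=0\}$. Then $\mathbb E N(r)<\infty$ for every $r\in(0,1)$, and as $r\to1$ from below the following hold. (I) If $\frac{a^2}{8}+(b-\frac14)^2=\frac1{16}$ and $\frac16<b\le\frac12$, then $$\mathbb E N(r)=\frac{r^2}{1-r^2}-\sqrt{\frac{2b}{6b-1}}\,\frac1{(1-r^2)^{1/2}}+O(1).$$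 (II) If $b=|a|-\frac12$ and $-\frac12<b<\frac16$, then $$\mathbb E N(r)=\frac{r^2}{1-r^2}-\frac12\sqrt{\frac{1-2b}{1-6b}}\,\frac1{(1-r^2)^{1/2}}+O(1).$$ At the common endpoint $(a,b)=(0,-\frac12)$ of the two segments the constant is twice the value of this expression at $b=-\frac12$: $$\mathbb E N(r)=\frac{r^2}{1-r^2}-\frac1{\sqrt2}\,\frac1{(1-r^2)^{1/2}}+O(1).$$ (III) If $(a,b)=(\pm\frac23,\frac16)$, then $$\mathbb E N(r)=\frac{r^2}{1-r^2}-\frac1{2^{5/4}}\,\frac1{(1-r^2)^{3/4}}+O\Big(\frac1{(1-r^2)^{1/4}}\Big).$$ (IV) If $(a,b)$ is in the interior of $\mathcal P$, then there is a constant $C(a,b)\ge0$, depending only on $(a,b)$, such that $$\mathbb E N(r)=\frac{r^2}{1-r^2}-C(a,b)+O(1-r^2),$$ and $C(a,b)>0$ except that $C(0,0)=0$. -/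

import Mathlib

open MeasureTheory ProbabilityTheory Filter Topology Asymptotics

namespace TwoDependentGAF

/-- `ξ = (ξ_k)_{k ∈ ℤ}` is a stationary, centered, complex Gaussian process with covariance function
`γ`, that is `E[ξ_k conj(ξ_l)] = γ(l - k)`.  As usual "complex Gaussian" means circularly symmetric:
the finite-dimensional distributions are jointly Gaussian over `ℝ` and the pseudo-covariances
`E[ξ_k ξ_l]` vanish.  (Joint Gaussianity contains measurability up to null sets and gives the
integrability of all the integrands below.) -/
structure IsStationaryComplexGaussian {Ω : Type*} [MeasurableSpace Ω] (P : Measure Ω)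
    (ξ : ℤ → Ω → ℂ) (γ : ℤ → ℂ) : Prop where
  isGaussianProcess : IsGaussianProcess ξ P
  centered : ∀ k, ∫ ω, ξ k ω ∂P = 0
  pseudoCovariance : ∀ k l, ∫ ω, ξ k ω * ξ l ω ∂P = 0
  covariance : ∀ k l, ∫ ω, ξ k ω * (starRingEnd ℂ) (ξ l ω) ∂P = γ (l - k)

/-- The covariance function `γ(0) = 1`, `γ(±1) = a`, `γ(±2) = b`, and `γ(k) = 0` otherwise. -/
noncomputable def gamma (a b : ℝ) (k : ℤ) : ℂ :=
  if k = 0 then 1 else if |k| = 1 then (a : ℂ) else if |k| = 2 then (b : ℂ) else 0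

/-- The elliptic part of the region of positive definiteness. -/
def region₁ : Set (ℝ × ℝ) :=
  {p | p.1 ^ 2 / 8 + (p.2 - 1 / 4) ^ 2 ≤ 1 / 16}

/-- The triangular part of the region of positive definiteness. -/
def region₂ : Set (ℝ × ℝ) :=
  {p | 1 / 16 ≤ p.1 ^ 2 / 8 + (p.2 - 1 / 4) ^ 2 ∧ |p.1| - 1 / 2 ≤ p.2 ∧ p.2 ≤ 1 / 6}

/-- The set of `(a, b)` for which `gamma a b` is positive definite. -/
def region : Set (ℝ × ℝ) := region₁ ∪ region₂

/-- The random power series `f(z) = ∑_{k ≥ 0} ξ_k z^k`. -/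
noncomputable def powerSeries {Ω : Type*} (ξ : ℤ → Ω → ℂ) (ω : Ω) (z : ℂ) : ℂ :=
  ∑' k : ℕ, ξ (k : ℤ) ω * z ^ k

/-- `N_f(r)`, the number (possibly infinite) of zeros of `f` in the open disk of radius `r`. -/
noncomputable def zeroCount {Ω : Type*} (ξ : ℤ → Ω → ℂ) (r : ℝ) (ω : Ω) : ℕ∞ :=
  {z : ℂ | ‖z‖ < r ∧ powerSeries ξ ω z = 0}.encard

/-- `E N_f(r)`, as an extended nonnegative number. -/
noncomputable def expectedZeroCount {Ω : Type*} [MeasurableSpace Ω] (P : Measure Ω)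
    (ξ : ℤ → Ω → ℂ) (r : ℝ) : ENNReal :=
  ∫⁻ ω, (zeroCount ξ r ω : ENNReal) ∂P

end TwoDependentGAF

/-! For fixed `z` in the disk, `f z` is a centered circularly symmetric Gaussian of variance `K(z) =
h(z) / (1 - |z|²)`, with `h(z) = 1 + 2a Re z + 2b Re z²` positive on the disk. Hence `E log |f z| =
½ log K(z) + const`, the constant being independent of `z`.

Write `L(r)` for the average of `log K` over `|z| = r`. Jensen's formula gives, for `s < r`, `E N(s)
log (r / s) ≤ ½ (L(r) - L(s)) ≤ E N(r) log (r / s)`; the second inequality needs the zeros to be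
almost surely simple, because `N` counts points without multiplicity. As `L` is differentiable,
letting `s` and `r` come together gives `E N(r) = (r / 2) L'(r)`. The factor `1 / (1 - |z|²)`
contributes `r² / (1 - r²)`, and `h` contributes `excess a b r`, the average of half the logarithmic
radial derivative of `h`. No intensity of zeros is ever computed
(`IsStationaryComplexGaussian.expectedZeroCount_eq`).

The rest is analysis of the excess. On `|z| = r`, `h` is a polynomial of degree at most two in `x =
Re z`, so partial fractions reduce everything to the average of `1 / (u + x)`, which is `1 / √(u² -
r²)` (`circleAverage_inv_add_re`). The singular behaviour reflects the zeros of `h` on the unit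
circle: on the arc the roots in `x` are a conjugate pair at distance of order `√(1 - r²)` from a
point of `(-1, 1)`; on a segment one root approaches `1` or `-1`; at the corner there is one at each
end, which doubles the constant; at the cusps the conjugate pair approaches an endpoint, which gives
the exponent `3/4`.

In the interior `h` is positive on the closed disk, so the excess is differentiable at `r = 1`. It
vanishes at `0` and strictly decreases unless `a = b = 0`, because the logarithm of a positive
nonconstant harmonic function is superharmonic and not harmonic. -/

namespace TwoDependentGAF
-- Circular Gaussian partial sums
section Gaussian
variable {Ω : Type*} [MeasurableSpace Ω] {P : Measure Ω} {ξ : ℤ → Ω → ℂ} {γ : ℤ → ℂ}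

lemma IsStationaryComplexGaussian.memLp_two (h : IsStationaryComplexGaussian P ξ γ) (k : ℤ) :
    MemLp (ξ k) 2 P :=
  (h.1.hasGaussianLaw_eval k).memLp_two

lemma IsStationaryComplexGaussian.integrable_mul (h : IsStationaryComplexGaussian P ξ γ)
    (k l : ℤ) : Integrable (fun ω ↦ ξ k ω * ξ l ω) P :=
  (h.memLp_two k).integrable_mul (h.memLp_two l)

lemma IsStationaryComplexGaussian.integrable_mul_conj (h : IsStationaryComplexGaussian P ξ γ)
    (k l : ℤ) : Integrable (fun ω ↦ ξ k ω * (starRingEnd ℂ) (ξ l ω)) P :=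
  (h.memLp_two k).integrable_mul (h.memLp_two l).star

/-- The partial sums of the random power series. -/
noncomputable def partialSum (ξ : ℤ → Ω → ℂ) (z : ℂ) (n : ℕ) (ω : Ω) : ℂ :=
  ∑ k ∈ Finset.range n, ξ (k : ℤ) ω * z ^ k

lemma IsStationaryComplexGaussian.hasGaussianLaw_partialSum
    (h : IsStationaryComplexGaussian P ξ γ) (z : ℂ) (n : ℕ) :
    HasGaussianLaw (partialSum ξ z n) P := by
  have h1 := (h.1.comp_right (fun k : ℕ ↦ (k : ℤ))).comp_left
    (fun k : ℕ ↦ ((ContinuousLinearMap.mul ℝ ℂ) (z ^ k)))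
  have h2 := h1.hasGaussianLaw_fun_sum (I := Finset.range n)
  refine h2.congr (ae_of_all _ fun ω ↦ ?_)
  simp [partialSum, mul_comm]

lemma IsStationaryComplexGaussian.integral_partialSum
    (h : IsStationaryComplexGaussian P ξ γ) (z : ℂ) (n : ℕ) :
    ∫ ω, partialSum ξ z n ω ∂P = 0 := by
  unfold partialSum
  rw [integral_finsetSum]
  · simp [integral_mul_const, h.centered]
  · intro k _
    exact ((h.1.hasGaussianLaw_eval k).integrable).mul_const _

lemma IsStationaryComplexGaussian.integral_partialSum_sq
    (h : IsStationaryComplexGaussian P ξ γ) (z : ℂ) (n : ℕ) :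
    ∫ ω, partialSum ξ z n ω ^ 2 ∂P = 0 := by
  have : ∀ ω, partialSum ξ z n ω ^ 2 = ∑ k ∈ Finset.range n, ∑ l ∈ Finset.range n,
      (ξ k ω * ξ l ω) * (z ^ k * z ^ l) := fun ω ↦ by
    rw [sq, partialSum, Finset.sum_mul_sum]
    exact Finset.sum_congr rfl fun k _ ↦ Finset.sum_congr rfl fun l _ ↦ by ring
  simp_rw [this]
  rw [integral_finsetSum _ fun (k : ℕ) _ ↦ integrable_finsetSum _ fun (l : ℕ) _ ↦
    (h.integrable_mul k l).mul_const _]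
  refine Finset.sum_eq_zero fun k _ ↦ ?_
  rw [integral_finsetSum _ fun (l : ℕ) _ ↦ (h.integrable_mul k l).mul_const _]
  exact Finset.sum_eq_zero fun l _ ↦ by rw [integral_mul_const, h.pseudoCovariance, zero_mul]

lemma IsStationaryComplexGaussian.integral_partialSum_mul_conj
    (h : IsStationaryComplexGaussian P ξ γ) (z : ℂ) (n : ℕ) :
    ∫ ω, partialSum ξ z n ω * (starRingEnd ℂ) (partialSum ξ z n ω) ∂P =
      ∑ k ∈ Finset.range n, ∑ l ∈ Finset.range n,
        γ (l - k) * (z ^ k * (starRingEnd ℂ) z ^ l) := by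
  have : ∀ ω, partialSum ξ z n ω * (starRingEnd ℂ) (partialSum ξ z n ω) =
      ∑ k ∈ Finset.range n, ∑ l ∈ Finset.range n,
      (ξ k ω * (starRingEnd ℂ) (ξ l ω)) * (z ^ k * (starRingEnd ℂ) z ^ l) := fun ω ↦ by
    rw [partialSum, map_sum, Finset.sum_mul_sum]
    exact Finset.sum_congr rfl fun k _ ↦ Finset.sum_congr rfl fun l _ ↦ by
      rw [map_mul, map_pow]; ring
  simp_rw [this]
  rw [integral_finsetSum _ fun (k : ℕ) _ ↦ integrable_finsetSum _ fun (l : ℕ) _ ↦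
    (h.integrable_mul_conj k l).mul_const _]
  refine Finset.sum_congr rfl fun k _ ↦ ?_
  rw [integral_finsetSum _ fun (l : ℕ) _ ↦ (h.integrable_mul_conj k l).mul_const _]
  exact Finset.sum_congr rfl fun l _ ↦ by rw [integral_mul_const, h.covariance]

/-- Separates the part seen by `E |X|²` from the part seen by the pseudo-covariance `E X²`. When the
latter vanishes, the variance of a real coordinate depends on `t` only through `‖t‖`. -/
lemma real_inner_sq (t w : ℂ) : (inner ℝ t w : ℝ) ^ 2 =
    1 / 2 * (‖t‖ ^ 2 * (w * (starRingEnd ℂ) w).re) + 1 / 2 * ((starRingEnd ℂ) t ^ 2 * w ^ 2).re := by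
  rw [← Complex.normSq_eq_norm_sq]
  simp [Complex.inner, Complex.normSq_apply, pow_two]
  ring

section Circular
variable {X : Ω → ℂ} {V : ℝ}

lemma integral_inner_of_centered (hX : HasGaussianLaw X P) (h0 : ∫ ω, X ω ∂P = 0) (t : ℂ) :
    ∫ ω, (inner ℝ t (X ω) : ℝ) ∂P = 0 := by
  rw [integral_inner hX.integrable, h0, inner_zero_right]

lemma variance_inner_of_circular (hX : HasGaussianLaw X P) (h0 : ∫ ω, X ω ∂P = 0)
    (h1 : ∫ ω, X ω ^ 2 ∂P = 0) (h2 : ∫ ω, X ω * (starRingEnd ℂ) (X ω) ∂P = V) (t : ℂ) :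
    Var[fun ω ↦ (inner ℝ t (X ω) : ℝ); P] = ‖t‖ ^ 2 * V / 2 := by
  have hi2 : Integrable (fun ω ↦ X ω ^ 2) P := by
    simp_rw [sq]
    exact hX.memLp_two.integrable_mul hX.memLp_two
  have hi3 : Integrable (fun ω ↦ X ω * (starRingEnd ℂ) (X ω)) P :=
    hX.memLp_two.integrable_mul hX.memLp_two.star
  rw [variance_of_integral_eq_zero (by have := hX.aemeasurable; fun_prop)
    (integral_inner_of_centered hX h0 t)]
  simp_rw [real_inner_sq]
  have e1 : ∫ ω, (X ω * (starRingEnd ℂ) (X ω)).re ∂P = V := by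
    have := integral_re hi3
    simp only [RCLike.re_eq_complex_re] at this
    rw [this, h2, Complex.ofReal_re]
  have e2 : ∫ ω, ((starRingEnd ℂ) t ^ 2 * X ω ^ 2).re ∂P = 0 := by
    have := integral_re (hi2.const_mul ((starRingEnd ℂ) t ^ 2))
    simp only [RCLike.re_eq_complex_re] at this
    rw [this, integral_const_mul, h1, mul_zero, Complex.zero_re]
  rw [integral_add, integral_const_mul, integral_const_mul, integral_const_mul, e1, e2]
  · ring
  · exact (hi3.re.const_mul _).const_mul _
  · exact (hi2.const_mul _).re.const_mul _

/-- A centered circularly symmetric complex Gaussian variable has a rotation invariant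
characteristic function. -/
lemma charFun_map_of_circular (hX : HasGaussianLaw X P) (h0 : ∫ ω, X ω ∂P = 0)
    (h1 : ∫ ω, X ω ^ 2 ∂P = 0) (h2 : ∫ ω, X ω * (starRingEnd ℂ) (X ω) ∂P = V) (t : ℂ) :
    charFun (P.map X) t = Complex.exp (-((‖t‖ ^ 2 * V / 4 : ℝ) : ℂ)) := by
  rw [hX.charFun_map_eq, integral_inner_of_centered hX h0, variance_inner_of_circular hX h0 h1 h2]
  congr 1
  push_cast
  ring

end Circular
end Gaussian
end TwoDependentGAF

/-! ### The covariance kernel and the law of the series at a point -/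

namespace TwoDependentGAF
/-- The spectral harmonic function `1 + 2 a Re z + 2 b Re z ^ 2`. -/
noncomputable def harm (a b : ℝ) (z : ℂ) : ℝ := 1 + 2 * a * z.re + 2 * b * (z ^ 2).re

/-- The covariance kernel of the random power series on the diagonal. -/
noncomputable def kernel (a b : ℝ) (z : ℂ) : ℝ := harm a b z / (1 - ‖z‖ ^ 2)

@[simp] lemma gamma_zero (a b : ℝ) : gamma a b 0 = 1 := by simp [gamma]

lemma gamma_neg (a b : ℝ) (k : ℤ) : gamma a b (-k) = gamma a b k := by simp [gamma]

lemma gamma_one (a b : ℝ) : gamma a b 1 = a := by simp [gamma]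

lemma gamma_two (a b : ℝ) : gamma a b 2 = b := by simp [gamma]

lemma gamma_of_two_lt (a b : ℝ) {k : ℤ} (hk : 2 < |k|) : gamma a b k = 0 := by
  have h0 : k ≠ 0 := by rintro rfl; simp at hk
  rw [gamma, if_neg h0, if_neg (by omega), if_neg (by omega)]

lemma sum_gamma_row (a b : ℝ) (z w : ℂ) (n : ℕ) :
    ∑ l ∈ Finset.range (n + 2), gamma a b (l - (n + 2 : ℕ)) * (z ^ (n + 2) * w ^ l) =
      a * (z ^ (n + 2) * w ^ (n + 1)) + b * (z ^ (n + 2) * w ^ n) := by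
  rw [Finset.sum_range_succ, Finset.sum_range_succ, Finset.sum_eq_zero]
  · have e1 : ((n : ℕ) : ℤ) - ((n + 2 : ℕ) : ℤ) = -2 := by push_cast; ring
    have e2 : ((n + 1 : ℕ) : ℤ) - ((n + 2 : ℕ) : ℤ) = -1 := by push_cast; ring
    rw [e1, e2, gamma_neg, gamma_neg, gamma_one, gamma_two]
    ring
  · intro l hl
    rw [Finset.mem_range] at hl
    rw [gamma_of_two_lt, zero_mul]
    rw [abs_of_nonpos (by push_cast; omega)]
    push_cast
    omega

/-- The matrix `gamma a b (l - k)` is a band of width two, so the sum splits along its diagonals;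
the one at distance `j` carries `n + 2 - j` geometric terms. The induction adds the last row and
column. -/
lemma sum_gamma (a b : ℝ) (z w : ℂ) (n : ℕ) :
    ∑ k ∈ Finset.range (n + 2), ∑ l ∈ Finset.range (n + 2), gamma a b (l - k) * (z ^ k * w ^ l) =
      ∑ k ∈ Finset.range (n + 2), (z * w) ^ k + a * (z + w) * ∑ k ∈ Finset.range (n + 1), (z * w) ^ k
        + b * (z ^ 2 + w ^ 2) * ∑ k ∈ Finset.range n, (z * w) ^ k := by
  induction n with
  | zero =>
    simp [Finset.sum_range_succ, gamma_neg a b 1, gamma_one]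
    ring
  | succ n ih =>
    rw [Finset.sum_range_succ]
    simp_rw [Finset.sum_range_succ _ (n + 2)]
    rw [Finset.sum_add_distrib, ih, sum_gamma_row]
    have hcol : ∑ k ∈ Finset.range (n + 2), gamma a b ((n + 2 : ℕ) - k) * (z ^ k * w ^ (n + 2)) =
        a * (w ^ (n + 2) * z ^ (n + 1)) + b * (w ^ (n + 2) * z ^ n) := by
      rw [← sum_gamma_row]
      refine Finset.sum_congr rfl fun k _ ↦ ?_
      rw [← gamma_neg, neg_sub]
      ring
    rw [hcol, sub_self, gamma_zero, Finset.sum_range_succ _ (n + 1), Finset.sum_range_succ _ n]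
    simp only [mul_pow]
    ring

lemma tendsto_sum_gamma (a b : ℝ) {z : ℂ} (hz : ‖z‖ < 1) :
    Tendsto (fun n ↦ ∑ k ∈ Finset.range n, ∑ l ∈ Finset.range n,
        gamma a b (l - k) * (z ^ k * (starRingEnd ℂ) z ^ l)) atTop (𝓝 (kernel a b z : ℂ)) := by
  rw [← tendsto_add_atTop_iff_nat 2]
  simp_rw [sum_gamma]
  have hq : ‖z * (starRingEnd ℂ) z‖ < 1 := by
    rw [norm_mul, RCLike.norm_conj]
    nlinarith [norm_nonneg z]
  have hs := (hasSum_geometric_of_norm_lt_one hq).tendsto_sum_nat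
  have h2 := (tendsto_add_atTop_iff_nat 2).2 hs
  have h1 := (tendsto_add_atTop_iff_nat 1).2 hs
  convert (h2.add (h1.const_mul (a * (z + (starRingEnd ℂ) z)))).add
    (hs.const_mul (b * (z ^ 2 + (starRingEnd ℂ) z ^ 2))) using 2
  have e3 : z ^ 2 + (starRingEnd ℂ) z ^ 2 = ((2 * (z ^ 2).re : ℝ) : ℂ) := by
    rw [← map_pow, Complex.add_conj]
  rw [Complex.add_conj, e3, Complex.mul_conj, Complex.normSq_eq_norm_sq, kernel, harm]
  push_cast
  ring

section Series
variable {Ω : Type*} [MeasurableSpace Ω] {P : Measure Ω} [IsProbabilityMeasure P]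
  {ξ : ℤ → Ω → ℂ} {a b : ℝ}

/-- Almost sure convergence of the random power series in the unit disk. -/
lemma IsStationaryComplexGaussian.ae_summable
    (h : IsStationaryComplexGaussian P ξ (gamma a b)) :
    ∀ᵐ ω ∂P, ∀ s : ℝ, 0 ≤ s → s < 1 → Summable fun k : ℕ ↦ ‖ξ k ω‖ * s ^ k := by
  have key : ∀ s : ℝ, 0 ≤ s → s < 1 → ∀ᵐ ω ∂P, Summable fun k : ℕ ↦ ‖ξ k ω‖ * s ^ k := by
    intro s hs hs1
    have hmeas : ∀ k : ℕ, AEMeasurable (fun ω ↦ ‖ξ k ω * (s : ℂ) ^ k‖ₑ) P := fun k ↦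
      ((h.1.aemeasurable k).mul_const _).enorm
    have hE : ∀ k : ℤ, ∫⁻ ω, ‖ξ k ω‖ₑ ∂P ≤ 1 := by
      intro k
      have hsq : ∫ ω, ‖ξ k ω‖ ^ 2 ∂P = 1 := by
        have := h.covariance k k
        simp only [sub_self, gamma_zero, Complex.mul_conj, Complex.normSq_eq_norm_sq] at this
        rw [integral_complex_ofReal] at this
        exact_mod_cast this
      have hi : Integrable (fun ω ↦ ‖ξ k ω‖ ^ 2) P := (h.memLp_two k).integrable_norm_pow (by simp)
      have hi1 : Integrable (ξ k) P := (h.memLp_two k).integrable (by norm_num)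
      rw [← ofReal_integral_norm_eq_lintegral_enorm hi1, ← ENNReal.ofReal_one]
      apply ENNReal.ofReal_le_ofReal
      -- `t ≤ (1 + t²) / 2` bounds the first absolute moment by the second, uniformly in `k`.
      calc ∫ ω, ‖ξ k ω‖ ∂P ≤ ∫ ω, (1 / 2 + 1 / 2 * ‖ξ k ω‖ ^ 2) ∂P :=
            integral_mono hi1.norm ((integrable_const _).add (hi.const_mul _))
              fun ω ↦ by nlinarith [sq_nonneg (‖ξ k ω‖ - 1)]
        _ = 1 := by
            rw [integral_add (integrable_const _) (hi.const_mul _), integral_const_mul, hsq]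
            simp
            norm_num
    have hfin : ∫⁻ ω, ∑' k : ℕ, ‖ξ k ω * (s : ℂ) ^ k‖ₑ ∂P ≠ ⊤ := by
      rw [lintegral_tsum hmeas]
      have hb : ∀ k : ℕ, ∫⁻ ω, ‖ξ k ω * (s : ℂ) ^ k‖ₑ ∂P ≤ ENNReal.ofReal (s ^ k) := fun k ↦ by
        simp_rw [enorm_mul]
        rw [lintegral_mul_const' _ _ enorm_ne_top]
        have : ‖(s : ℂ) ^ k‖ₑ = ENNReal.ofReal (s ^ k) := by
          rw [← ofReal_norm, norm_pow, Complex.norm_real, Real.norm_of_nonneg hs]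
        rw [this]
        exact mul_le_of_le_one_left zero_le (hE k)
      refine ne_top_of_le_ne_top ?_ (ENNReal.tsum_le_tsum hb)
      exact (summable_geometric_of_lt_one hs hs1).tsum_ofReal_ne_top
    filter_upwards [ae_lt_top' (AEMeasurable.tsum hmeas) hfin] with ω hω
    have := (ENNReal.tsum_coe_ne_top_iff_summable (f := fun k : ℕ ↦ ‖ξ k ω * (s : ℂ) ^ k‖₊)).1 hω.ne
    have := NNReal.summable_coe.2 this
    simpa [abs_of_nonneg hs] using this
  -- The exceptional null set depends on `s`; the countably many radii `1 - 1 / (m + 1)` dominate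
  -- all others.
  have hall := ae_all_iff.2 fun m : ℕ ↦ key (1 - 1 / ((m : ℝ) + 1))
    (by rw [sub_nonneg, div_le_one (by positivity)]; linarith [m.cast_nonneg (α := ℝ)])
    (by have : (0 : ℝ) < 1 / ((m : ℝ) + 1) := by positivity
        linarith)
  filter_upwards [hall] with ω hω s hs hs1
  obtain ⟨m, hm⟩ := exists_nat_one_div_lt (sub_pos.2 hs1)
  refine Summable.of_nonneg_of_le (fun k ↦ by positivity) (fun k ↦ ?_) (hω m)
  gcongr
  linarith

lemma summable_of_summable_norm {c : ℕ → ℂ} {z : ℂ}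
    (h : Summable fun k : ℕ ↦ ‖c k‖ * ‖z‖ ^ k) : Summable fun k : ℕ ↦ c k * z ^ k :=
  Summable.of_norm (by simpa using h)

lemma IsStationaryComplexGaussian.ae_tendsto_partialSum
    (h : IsStationaryComplexGaussian P ξ (gamma a b)) {z : ℂ} (hz : ‖z‖ < 1) :
    ∀ᵐ ω ∂P, Tendsto (fun n ↦ partialSum ξ z n ω) atTop (𝓝 (powerSeries ξ ω z)) := by
  filter_upwards [h.ae_summable] with ω hω
  exact (summable_of_summable_norm (c := fun k ↦ ξ k ω)
    (hω ‖z‖ (norm_nonneg z) hz)).hasSum.tendsto_sum_nat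

lemma IsStationaryComplexGaussian.aemeasurable_powerSeries
    (h : IsStationaryComplexGaussian P ξ (gamma a b)) {z : ℂ} (hz : ‖z‖ < 1) :
    AEMeasurable (fun ω ↦ powerSeries ξ ω z) P :=
  aemeasurable_of_tendsto_metrizable_ae' 
    (fun n ↦ (h.hasGaussianLaw_partialSum z n).aemeasurable) (h.ae_tendsto_partialSum hz)

/-- Pass to the limit in the characteristic functions of the partial sums: the left side by
dominated convergence, the right side by convergence of the variances. -/
lemma IsStationaryComplexGaussian.charFun_powerSeries
    (h : IsStationaryComplexGaussian P ξ (gamma a b)) {z : ℂ} (hz : ‖z‖ < 1) (t : ℂ) :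
    charFun (P.map fun ω ↦ powerSeries ξ ω z) t =
      Complex.exp (-((‖t‖ ^ 2 * kernel a b z / 4 : ℝ) : ℂ)) := by
  -- The double sum is `E |S_n|²`, hence real, as the circular characteristic function requires.
  have hreal : ∀ n, ∑ k ∈ Finset.range n, ∑ l ∈ Finset.range n,
        gamma a b (l - k) * (z ^ k * (starRingEnd ℂ) z ^ l) =
      ((∑ k ∈ Finset.range n, ∑ l ∈ Finset.range n,
        gamma a b (l - k) * (z ^ k * (starRingEnd ℂ) z ^ l)).re : ℂ) := fun n ↦ by
    rw [← h.integral_partialSum_mul_conj]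
    simp_rw [Complex.mul_conj]
    rw [integral_complex_ofReal, Complex.ofReal_re]
  have hn : ∀ n, charFun (P.map (partialSum ξ z n)) t = _ := fun n ↦
    charFun_map_of_circular (h.hasGaussianLaw_partialSum z n) (h.integral_partialSum z n)
      (h.integral_partialSum_sq z n) ((h.integral_partialSum_mul_conj z n).trans (hreal n)) t
  have hlim := (Complex.continuous_re.tendsto _).comp (tendsto_sum_gamma a b hz)
  rw [Complex.ofReal_re] at hlim
  have hR : Tendsto (fun n ↦ charFun (P.map (partialSum ξ z n)) t) atTop
      (𝓝 (Complex.exp (-((‖t‖ ^ 2 * kernel a b z / 4 : ℝ) : ℂ)))) := by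
    simp_rw [hn]
    refine (Complex.continuous_exp.tendsto _).comp (Tendsto.neg ?_)
    exact (Complex.continuous_ofReal.tendsto _).comp ((hlim.const_mul _).div_const _)
  refine tendsto_nhds_unique ?_ hR
  simp_rw [charFun_apply]
  rw [integral_map (h.aemeasurable_powerSeries hz) (by fun_prop)]
  simp_rw [integral_map (h.hasGaussianLaw_partialSum z _).aemeasurable
    (show AEStronglyMeasurable (fun x : ℂ ↦ Complex.exp (((inner ℝ x t : ℝ) : ℂ) * Complex.I)) _ by
      fun_prop)]
  refine tendsto_integral_of_dominated_convergence (fun _ ↦ 1) (fun n ↦ ?_) (integrable_const _)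
    (fun n ↦ ae_of_all _ fun ω ↦ (Complex.norm_exp_ofReal_mul_I _).le) ?_
  · have := (h.hasGaussianLaw_partialSum z n).aemeasurable
    fun_prop
  · filter_upwards [h.ae_tendsto_partialSum hz] with ω hω
    have hc : Continuous fun x : ℂ ↦ Complex.exp (((inner ℝ x t : ℝ) : ℂ) * Complex.I) := by
      fun_prop
    exact (hc.tendsto _).comp hω

/-- Equal characteristic functions. Questions about `|f z|` at a single point thereby become
questions about the one variable `ξ 0`. -/
lemma IsStationaryComplexGaussian.map_powerSeries
    (h : IsStationaryComplexGaussian P ξ (gamma a b)) {z : ℂ} (hz : ‖z‖ < 1)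
    (hK : 0 < kernel a b z) :
    P.map (fun ω ↦ powerSeries ξ ω z) = P.map (fun ω ↦ (√(kernel a b z) : ℂ) * ξ 0 ω) := by
  have hm0 := h.1.aemeasurable 0
  have h0 : ∀ t, charFun (P.map (ξ 0)) t = Complex.exp (-((‖t‖ ^ 2 * 1 / 4 : ℝ) : ℂ)) := fun t ↦
    charFun_map_of_circular (h.1.hasGaussianLaw_eval 0) (h.centered 0)
      (by simpa [sq] using h.pseudoCovariance 0 0) (by simpa using h.covariance 0 0) t
  have := Measure.isProbabilityMeasure_map (μ := P) (h.aemeasurable_powerSeries hz)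
  have := Measure.isProbabilityMeasure_map (μ := P) (hm0.const_mul (√(kernel a b z) : ℂ))
  refine Measure.ext_of_charFun (funext fun t ↦ ?_)
  have e : (fun ω ↦ (√(kernel a b z) : ℂ) * ξ 0 ω) = fun ω ↦ √(kernel a b z) • ξ 0 ω := by
    ext; simp
  have e2 : P.map (fun ω ↦ √(kernel a b z) • ξ 0 ω) = (P.map (ξ 0)).map (√(kernel a b z) • ·) := by
    rw [AEMeasurable.map_map_of_aemeasurable (by fun_prop) hm0]
    rfl
  rw [h.charFun_powerSeries hz, e, e2, charFun_map_smul, h0, norm_smul, mul_pow, Real.norm_eq_abs,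
    sq_abs, Real.sq_sqrt hK.le]
  congr 3
  ring

end Series
end TwoDependentGAF

/-! ### Small-ball estimates and integrability of the logarithm -/

namespace TwoDependentGAF

/-- The density is at most `1 / √π ≤ 1`. Variance `1/2` is that of each coordinate when `E |X|² =
1`. -/
lemma gaussianReal_half_le_volume {v : NNReal} (hv : (v : ℝ) = 1 / 2) :
    gaussianReal 0 v ≤ volume := by
  have hv0 : v ≠ 0 := by rintro rfl; norm_num at hv
  rw [gaussianReal_of_var_ne_zero _ hv0]
  refine (withDensity_mono (ae_of_all _ fun x ↦ ?_)).trans_eq withDensity_one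
  rw [gaussianPDF, Pi.one_apply, ENNReal.ofReal_le_one, gaussianPDFReal, hv]
  have h1 : (√(2 * Real.pi * (1 / 2)))⁻¹ ≤ 1 := by
    apply inv_le_one_of_one_le₀
    rw [Real.one_le_sqrt]
    linarith [Real.pi_gt_three]
  have h2 : Real.exp (-(x - 0) ^ 2 / (2 * (1 / 2))) ≤ 1 := by
    rw [Real.exp_le_one_iff]
    nlinarith [sq_nonneg (x - 0)]
  exact mul_le_one₀ h1 (Real.exp_nonneg _) h2

section Standard
variable {Ω : Type*} [MeasurableSpace Ω] {P : Measure Ω} {X : Ω → ℂ}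

/-- A real-linear coordinate of a standard complex Gaussian variable has density at most one. -/
lemma map_inner_le_volume (hX : HasGaussianLaw X P) (h0 : ∫ ω, X ω ∂P = 0)
    (h1 : ∫ ω, X ω ^ 2 ∂P = 0) (h2 : ∫ ω, X ω * (starRingEnd ℂ) (X ω) ∂P = (1 : ℝ)) {t : ℂ}
    (ht : ‖t‖ = 1) : P.map (fun ω ↦ (inner ℝ t (X ω) : ℝ)) ≤ volume := by
  have hg : HasGaussianLaw (fun ω ↦ (inner ℝ t (X ω) : ℝ)) P := hX.map (innerSL ℝ t)
  rw [hg.map_eq_gaussianReal, integral_inner_of_centered hX h0,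
    variance_inner_of_circular hX h0 h1 h2]
  apply gaussianReal_half_le_volume
  rw [ht]
  norm_num

lemma indepFun_re_im (hX : HasGaussianLaw X P) (h0 : ∫ ω, X ω ∂P = 0)
    (h1 : ∫ ω, X ω ^ 2 ∂P = 0) : IndepFun (fun ω ↦ (X ω).re) (fun ω ↦ (X ω).im) P := by
  have := hX.isProbabilityMeasure
  have hi2 : Integrable (fun ω ↦ X ω ^ 2) P := by
    simp_rw [sq]
    exact hX.memLp_two.integrable_mul hX.memLp_two
  refine HasGaussianLaw.indepFun_of_covariance_eq_zero
    (hX.map (Complex.reCLM.prod Complex.imCLM)) ?_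
  have hre : MemLp (fun ω ↦ (X ω).re) 2 P := (hX.map Complex.reCLM).memLp_two
  have him : MemLp (fun ω ↦ (X ω).im) 2 P := (hX.map Complex.imCLM).memLp_two
  rw [covariance_eq_sub hre him]
  have e0 : ∫ ω, (X ω).re ∂P = 0 := by
    have := integral_re hX.integrable
    simp only [RCLike.re_eq_complex_re] at this
    rw [this, h0, Complex.zero_re]
  have e1 : ∫ ω, (X ω ^ 2).im ∂P = 0 := by
    have := integral_im hi2
    simp only [RCLike.im_eq_complex_im] at this
    rw [this, h1, Complex.zero_im]
  have e2 : ∀ ω, (X ω).re * (X ω).im = 1 / 2 * (X ω ^ 2).im := fun ω ↦ by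
    rw [sq, Complex.mul_im]; ring
  simp only [Pi.mul_apply, e2]
  rw [integral_const_mul, e1, e0]
  simp

/-- The disk lies in a square, whose sides are controlled by independent coordinates of density at
most one. The power `t²` is what makes the grid argument for simple zeros converge. -/
lemma measure_norm_le (hX : HasGaussianLaw X P) (h0 : ∫ ω, X ω ∂P = 0)
    (h1 : ∫ ω, X ω ^ 2 ∂P = 0) (h2 : ∫ ω, X ω * (starRingEnd ℂ) (X ω) ∂P = (1 : ℝ)) {t : ℝ}
    (ht : 0 ≤ t) : P {ω | ‖X ω‖ ≤ t} ≤ ENNReal.ofReal (4 * t ^ 2) := by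
  have hm := hX.aemeasurable
  have hb : ∀ u : ℂ, ‖u‖ = 1 →
      P ((fun ω ↦ (inner ℝ u (X ω) : ℝ)) ⁻¹' Set.Icc (-t) t) ≤ ENNReal.ofReal (2 * t) := by
    intro u hu
    rw [← Measure.map_apply_of_aemeasurable (by fun_prop) measurableSet_Icc]
    refine (map_inner_le_volume hX h0 h1 h2 hu _).trans ?_
    rw [Real.volume_Icc]
    exact ENNReal.ofReal_le_ofReal (by linarith)
  have hre := hb 1 (by simp)
  have him := hb Complex.I (by simp)
  simp only [Complex.inner, map_one, mul_one, Complex.conj_I] at hre him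
  simp only [mul_neg, Complex.neg_re, Complex.mul_I_re, neg_neg] at him
  calc P {ω | ‖X ω‖ ≤ t}
      ≤ P (((fun ω ↦ (X ω).re) ⁻¹' Set.Icc (-t) t) ∩ ((fun ω ↦ (X ω).im) ⁻¹' Set.Icc (-t) t)) := by
        refine measure_mono fun ω (hω : ‖X ω‖ ≤ t) ↦ ⟨?_, ?_⟩
        · exact abs_le.1 ((Complex.abs_re_le_norm _).trans hω)
        · exact abs_le.1 ((Complex.abs_im_le_norm _).trans hω)
    _ = P ((fun ω ↦ (X ω).re) ⁻¹' Set.Icc (-t) t) * P ((fun ω ↦ (X ω).im) ⁻¹' Set.Icc (-t) t) :=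
        (indepFun_re_im hX h0 h1).measure_inter_preimage_eq_mul _ _ measurableSet_Icc
          measurableSet_Icc
    _ ≤ ENNReal.ofReal (2 * t) * ENNReal.ofReal (2 * t) := mul_le_mul' hre him
    _ = ENNReal.ofReal (4 * t ^ 2) := by
        rw [← ENNReal.ofReal_mul (by positivity)]
        ring_nf

/-- Where `‖X‖ ≥ 1` the logarithm is below `‖X‖`. Where `‖X‖ < 1` its absolute value is at most
`|log |Re X||`, integrable because `Re X` has density at most one and `log` is locally integrable.
-/
lemma integrable_log_norm (hX : HasGaussianLaw X P) (h0 : ∫ ω, X ω ∂P = 0)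
    (h1 : ∫ ω, X ω ^ 2 ∂P = 0) (h2 : ∫ ω, X ω * (starRingEnd ℂ) (X ω) ∂P = (1 : ℝ)) :
    Integrable (fun ω ↦ Real.log ‖X ω‖) P := by
  have hm := hX.aemeasurable
  have hle := map_inner_le_volume hX h0 h1 h2 (t := 1) (by simp)
  simp only [Complex.inner, map_one, mul_one] at hle
  have hmre : AEMeasurable (fun ω ↦ (X ω).re) P := by fun_prop
  have hlog : Integrable (fun ω ↦ (Set.Ioc (-1 : ℝ) 1).indicator Real.log (X ω).re) P := by
    have hv : Integrable ((Set.Ioc (-1 : ℝ) 1).indicator Real.log) volume := by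
      rw [integrable_indicator_iff measurableSet_Ioc]
      exact (intervalIntegral.intervalIntegrable_log' (a := -1) (b := 1)).1
    exact (hv.mono_measure hle).comp_aemeasurable hmre
  have hne : ∀ᵐ ω ∂P, (X ω).re ≠ 0 := by
    have : P ((fun ω ↦ (X ω).re) ⁻¹' {0}) = 0 := by
      rw [← Measure.map_apply_of_aemeasurable hmre (measurableSet_singleton 0)]
      exact le_antisymm ((hle _).trans (by simp)) zero_le
    exact measure_eq_zero_iff_ae_notMem.1 this
  refine Integrable.mono' (hX.integrable.norm.add hlog.norm)
    (Real.measurable_log.comp_aemeasurable hm.norm).aestronglyMeasurable ?_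
  filter_upwards [hne] with ω hω
  have hpos : 0 < |(X ω).re| := abs_pos.2 hω
  have hrele := Complex.abs_re_le_norm (X ω)
  rw [Pi.add_apply, Real.norm_eq_abs]
  by_cases h : 1 ≤ ‖X ω‖
  · rw [abs_of_nonneg (Real.log_nonneg h)]
    have := Real.log_le_sub_one_of_pos (hpos.trans_le hrele)
    linarith [norm_nonneg ((Set.Ioc (-1 : ℝ) 1).indicator Real.log (X ω).re)]
  · push Not at h
    have hmem : (X ω).re ∈ Set.Ioc (-1 : ℝ) 1 := by
      have := abs_lt.1 (hrele.trans_lt h)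
      exact ⟨this.1, this.2.le⟩
    rw [Set.indicator_of_mem hmem, Real.norm_eq_abs,
      abs_of_nonpos (Real.log_nonpos (norm_nonneg _) h.le), ← Real.log_abs (X ω).re,
      abs_of_nonpos (Real.log_nonpos (abs_nonneg _) (hrele.trans h.le))]
    linarith [Real.log_le_log hpos hrele, norm_nonneg (X ω)]

end Standard

section Series
variable {Ω : Type*} [MeasurableSpace Ω] {P : Measure Ω} {ξ : ℤ → Ω → ℂ} {a b : ℝ}

lemma IsStationaryComplexGaussian.integrable_log_zero
    (h : IsStationaryComplexGaussian P ξ (gamma a b)) :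
    Integrable (fun ω ↦ Real.log ‖ξ 0 ω‖) P :=
  integrable_log_norm (h.1.hasGaussianLaw_eval 0) (h.centered 0)
    (by simpa [sq] using h.pseudoCovariance 0 0) (by simpa using h.covariance 0 0)

variable [IsProbabilityMeasure P]

lemma IsStationaryComplexGaussian.measure_powerSeries_le
    (h : IsStationaryComplexGaussian P ξ (gamma a b)) {z : ℂ} (hz : ‖z‖ < 1)
    (hK : 0 < kernel a b z) {t : ℝ} (ht : 0 ≤ t) :
    P {ω | ‖powerSeries ξ ω z‖ ≤ t} ≤ ENNReal.ofReal (4 * t ^ 2 / kernel a b z) := by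
  have hm0 := h.1.aemeasurable 0
  have hset : MeasurableSet {w : ℂ | ‖w‖ ≤ t} := measurableSet_le (by fun_prop) (by fun_prop)
  have h1 : P {ω | ‖powerSeries ξ ω z‖ ≤ t} = P.map (fun ω ↦ powerSeries ξ ω z) {w | ‖w‖ ≤ t} := by
    rw [Measure.map_apply_of_aemeasurable (h.aemeasurable_powerSeries hz) hset]
    rfl
  rw [h1, h.map_powerSeries hz hK, Measure.map_apply_of_aemeasurable (by fun_prop) hset]
  have h2 := measure_norm_le (h.1.hasGaussianLaw_eval 0) (h.centered 0)
    (by simpa [sq] using h.pseudoCovariance 0 0) (by simpa using h.covariance 0 0)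
    (t := t / √(kernel a b z)) (by positivity)
  rw [div_pow, Real.sq_sqrt hK.le, ← mul_div_assoc] at h2
  refine (measure_mono fun ω hω ↦ ?_).trans h2
  simp only [Set.mem_preimage, Set.mem_ofPred_eq, norm_mul, Complex.norm_real,
    Real.norm_of_nonneg (Real.sqrt_nonneg _)] at hω
  rw [Set.mem_ofPred_eq, le_div_iff₀' (Real.sqrt_pos.2 hK)]
  exact hω

lemma IsStationaryComplexGaussian.ae_powerSeries_ne_zero
    (h : IsStationaryComplexGaussian P ξ (gamma a b)) {z : ℂ} (hz : ‖z‖ < 1)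
    (hK : 0 < kernel a b z) : ∀ᵐ ω ∂P, powerSeries ξ ω z ≠ 0 := by
  have h1 := h.measure_powerSeries_le hz hK le_rfl
  have : P {ω | powerSeries ξ ω z = 0} = 0 := by simpa using h1
  exact measure_eq_zero_iff_ae_notMem.1 this

/-- Functionals of the modulus of the random series at a point, in terms of `ξ 0`. -/
lemma IsStationaryComplexGaussian.integrable_and_integral_comp_norm
    (h : IsStationaryComplexGaussian P ξ (gamma a b)) {z : ℂ} (hz : ‖z‖ < 1)
    (hK : 0 < kernel a b z) :
    Integrable (fun ω ↦ Real.log ‖powerSeries ξ ω z‖) P ∧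
    ∫ ω, Real.log ‖powerSeries ξ ω z‖ ∂P =
      1 / 2 * Real.log (kernel a b z) + ∫ ω, Real.log ‖ξ 0 ω‖ ∂P ∧
    ∫ ω, ‖Real.log ‖powerSeries ξ ω z‖‖ ∂P ≤
      1 / 2 * |Real.log (kernel a b z)| + ∫ ω, ‖Real.log ‖ξ 0 ω‖‖ ∂P := by
  have hm0 := h.1.aemeasurable 0
  have hmf := h.aemeasurable_powerSeries hz
  have hz0 : kernel a b 0 = 1 := by simp [kernel, harm]
  have hne0 : ∀ᵐ ω ∂P, ξ 0 ω ≠ 0 := by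
    filter_upwards [h.ae_powerSeries_ne_zero (z := 0) (by simp) (by rw [hz0]; exact one_pos)]
      with ω hω h0
    apply hω
    rw [powerSeries, tsum_eq_single 0 fun k hk ↦ by simp [hk]]
    simpa using h0
  have hlaw := h.map_powerSeries hz hK
  have hlm : ∀ μ : Measure ℂ, AEStronglyMeasurable (fun w : ℂ ↦ Real.log ‖w‖) μ := fun μ ↦
    (by fun_prop : Measurable fun w : ℂ ↦ Real.log ‖w‖).aestronglyMeasurable
  have hae : (fun ω ↦ Real.log ‖(√(kernel a b z) : ℂ) * ξ 0 ω‖) =ᵐ[P]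
      fun ω ↦ 1 / 2 * Real.log (kernel a b z) + Real.log ‖ξ 0 ω‖ := by
    filter_upwards [hne0] with ω hω
    rw [norm_mul, Complex.norm_real, Real.norm_of_nonneg (Real.sqrt_nonneg _),
      Real.log_mul (Real.sqrt_pos.2 hK).ne' (norm_ne_zero_iff.2 hω), Real.log_sqrt hK.le]
    ring
  have hi : Integrable (fun ω ↦ Real.log ‖(√(kernel a b z) : ℂ) * ξ 0 ω‖) P :=
    ((integrable_const _).add h.integrable_log_zero).congr hae.symm
  -- Used with `F` the identity for the mean and `F` the norm for the `L¹` bound that Fubini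
  -- requires.
  have hint : ∀ F : ℝ → ℝ, Measurable F → ∫ ω, F (Real.log ‖powerSeries ξ ω z‖) ∂P =
      ∫ ω, F (1 / 2 * Real.log (kernel a b z) + Real.log ‖ξ 0 ω‖) ∂P := fun F hF ↦ by
    have hFm : ∀ μ : Measure ℂ, AEStronglyMeasurable (fun w : ℂ ↦ F (Real.log ‖w‖)) μ := fun μ ↦
      (by fun_prop : Measurable fun w : ℂ ↦ F (Real.log ‖w‖)).aestronglyMeasurable
    rw [← integral_map (f := fun w : ℂ ↦ F (Real.log ‖w‖)) hmf (hFm _), hlaw,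
      integral_map (by fun_prop) (hFm _)]
    exact integral_congr_ae (hae.fun_comp F)
  refine ⟨?_, ?_, ?_⟩
  · have := (integrable_map_measure (hlm _) (hm0.const_mul (√(kernel a b z) : ℂ))).2 hi
    rw [← hlaw] at this
    exact (integrable_map_measure (hlm _) hmf).1 this
  · have := hint id measurable_id
    simp only [id] at this
    rw [this, integral_add (integrable_const _) h.integrable_log_zero]
    simp
  · rw [hint _ measurable_norm]
    calc _ ≤ ∫ ω, (1 / 2 * |Real.log (kernel a b z)| + ‖Real.log ‖ξ 0 ω‖‖) ∂P := by
          refine integral_mono ((integrable_const _).add h.integrable_log_zero).norm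
            ((integrable_const _).add h.integrable_log_zero.norm) fun ω ↦ ?_
          refine (norm_add_le _ _).trans_eq ?_
          rw [norm_mul]
          norm_num
      _ = _ := by
          rw [integral_add (integrable_const _) h.integrable_log_zero.norm]
          simp

end Series
end TwoDependentGAF

/-! ### Jensen's formula and counting zeros -/

namespace TwoDependentGAF
section Jensen
open Metric Real

variable {f : ℂ → ℂ}

lemma divisor_closedBall_apply (hf : DifferentiableOn ℂ f (ball 0 1)) (h0 : f 0 ≠ 0) {r : ℝ}
    (hr : r < 1) {u : ℂ} (hu : u ∈ closedBall (0 : ℂ) r) :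
    MeromorphicOn.divisor f (closedBall 0 r) u = analyticOrderNatAt f u := by
  have han : AnalyticOnNhd ℂ f (ball 0 1) := hf.analyticOnNhd isOpen_ball
  have hsub : closedBall (0 : ℂ) r ⊆ ball 0 1 := closedBall_subset_ball hr
  rw [MeromorphicOn.AnalyticOnNhd.divisor_apply (han.mono hsub) hu]
  have hne : analyticOrderAt f u ≠ ⊤ := by
    refine han.analyticOrderAt_ne_top_of_isPreconnected (convex_ball 0 1).isPreconnected
      (x := 0) (by simp) (hsub hu) ?_
    rw [analyticOrderAt_eq_zero.2 (Or.inr h0)]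
    simp
  rw [← Nat.cast_analyticOrderNatAt hne]
  rfl

lemma analyticOrderNatAt_pos (hf : DifferentiableOn ℂ f (ball 0 1)) (h0 : f 0 ≠ 0) 
    {u : ℂ} (hu : u ∈ ball (0 : ℂ) 1) : 0 < analyticOrderNatAt f u ↔ f u = 0 := by
  have han : AnalyticOnNhd ℂ f (ball 0 1) := hf.analyticOnNhd isOpen_ball
  have hne : analyticOrderAt f u ≠ ⊤ := by
    refine han.analyticOrderAt_ne_top_of_isPreconnected (convex_ball 0 1).isPreconnected
      (x := 0) (by simp) hu ?_
    rw [analyticOrderAt_eq_zero.2 (Or.inr h0)]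
    simp
  rw [← (han u hu).analyticOrderAt_ne_zero, ← Nat.cast_analyticOrderNatAt hne, Nat.pos_iff_ne_zero]
  simp

/-- Jensen's formula on the disk of radius `R ≤ r`, as a sum over the zeros in the closed disk of
radius `r`. -/
lemma exists_finset_circleAverage_log (hf : DifferentiableOn ℂ f (ball 0 1)) (h0 : f 0 ≠ 0) {r : ℝ}
    (hr : r < 1) : ∃ F : Finset ℂ, (∀ u, u ∈ F ↔ ‖u‖ ≤ r ∧ f u = 0) ∧
      ∀ R, 0 < R → R ≤ r → circleAverage (fun z ↦ Real.log ‖f z‖) 0 R =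
        ∑ u ∈ F, analyticOrderNatAt f u * max 0 (Real.log (R / ‖u‖)) + Real.log ‖f 0‖ := by
  have han : AnalyticOnNhd ℂ f (ball 0 1) := hf.analyticOnNhd isOpen_ball
  have hfin := (MeromorphicOn.divisor f (closedBall 0 r)).finiteSupport (isCompact_closedBall _ _)
  have hF : ∀ u, u ∈ hfin.toFinset ↔ ‖u‖ ≤ r ∧ f u = 0 := by
    intro u
    rw [Set.Finite.mem_toFinset, Function.mem_support]
    by_cases hu : u ∈ closedBall (0 : ℂ) r
    · rw [divisor_closedBall_apply hf h0 hr hu]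
      rw [mem_closedBall_zero_iff] at hu
      rw [← analyticOrderNatAt_pos hf h0 (by simpa using hu.trans_lt hr), Nat.pos_iff_ne_zero]
      simp [hu]
    · rw [Function.locallyFinsuppWithin.apply_eq_zero_of_notMem _ hu]
      rw [mem_closedBall_zero_iff] at hu
      simp [hu]
  refine ⟨hfin.toFinset, hF, fun R hR hRr ↦ ?_⟩
  have hRabs : |R| = R := abs_of_pos hR
  rw [AnalyticOnNhd.circleAverage_log_norm hR.ne' (by
    rw [hRabs]; exact han.mono (closedBall_subset_ball (hRr.trans_lt hr))) h0, hRabs]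
  congr 1
  -- Zeros with `R < ‖u‖` are absent from the divisor, and `max 0` kills the same terms; so one
  -- finite set serves every `R ≤ r`.
  have hterm : ∀ u, (MeromorphicOn.divisor f (closedBall 0 R) u : ℝ) * Real.log (R * ‖0 - u‖⁻¹) =
      if ‖u‖ ≤ R then analyticOrderNatAt f u * Real.log (R / ‖u‖) else 0 := by
    intro u
    split_ifs with hu
    · rw [divisor_closedBall_apply hf h0 (hRr.trans_lt hr) (by simpa using hu), zero_sub, norm_neg,
        div_eq_mul_inv]
      simp
    · rw [Function.locallyFinsuppWithin.apply_eq_zero_of_notMem _ (by simpa using hu)]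
      simp
  simp_rw [hterm]
  rw [finsum_eq_sum_of_support_subset (s := hfin.toFinset)]
  · refine Finset.sum_congr rfl fun u hu ↦ ?_
    have hu0 : 0 < ‖u‖ := by
      rw [norm_pos_iff]
      rintro rfl
      exact h0 ((hF 0).1 hu).2
    split_ifs with h
    · rw [max_eq_right (Real.log_nonneg ((one_le_div hu0).2 h))]
    · rw [max_eq_left (Real.log_nonpos (by positivity) ((div_le_one hu0).2 (not_le.1 h).le)),
        mul_zero]
  · intro u hu
    rw [Function.mem_support] at hu
    rw [Finset.mem_coe, hF]
    split_ifs at hu with h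
    · refine ⟨h.trans hRr, ?_⟩
      rw [← analyticOrderNatAt_pos hf h0 (by simpa using (h.trans hRr).trans_lt hr)]
      by_contra hn
      simp only [not_lt, Nat.le_zero] at hn
      simp [hn] at hu
    · simp at hu

lemma encard_toENNReal_mul_ofReal {F : Finset ℂ} {c : ℝ} :
    (((F : Set ℂ).encard : ℕ∞) : ENNReal) * ENNReal.ofReal c = ENNReal.ofReal (F.card * c) := by
  rw [Set.encard_coe_eq_coe_finsetCard, ENNReal.ofReal_mul (by positivity)]
  simp

/-- An upper bound for the number of zeros from Jensen's formula. -/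
lemma encard_zeros_mul_log_le (hf : DifferentiableOn ℂ f (ball 0 1)) (h0 : f 0 ≠ 0) {s r : ℝ}
    (hs : 0 < s) (hsr : s < r) (hr : r < 1) :
    (({z : ℂ | ‖z‖ < s ∧ f z = 0}.encard : ℕ∞) : ENNReal) * ENNReal.ofReal (Real.log (r / s)) ≤
      ENNReal.ofReal (circleAverage (fun z ↦ Real.log ‖f z‖) 0 r -
        circleAverage (fun z ↦ Real.log ‖f z‖) 0 s) ∧
    0 ≤ circleAverage (fun z ↦ Real.log ‖f z‖) 0 r -
        circleAverage (fun z ↦ Real.log ‖f z‖) 0 s := by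
  classical
  obtain ⟨F, hF, hA⟩ := exists_finset_circleAverage_log hf h0 hr
  have hne : ∀ u ∈ F, 0 < ‖u‖ := fun u hu ↦ by
    rw [norm_pos_iff]
    rintro rfl
    exact h0 ((hF 0).1 hu).2
  have hset : {z : ℂ | ‖z‖ < s ∧ f z = 0} = ((F.filter (‖·‖ < s) : Finset ℂ) : Set ℂ) := by
    ext z
    simp only [Set.mem_ofPred_eq, Finset.coe_filter, hF]
    constructor
    · rintro ⟨h1, h2⟩
      exact ⟨⟨(h1.trans hsr).le, h2⟩, h1⟩
    · rintro ⟨⟨_, h2⟩, h1⟩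
      exact ⟨h1, h2⟩
  have hlog : 0 ≤ Real.log (r / s) := Real.log_nonneg ((one_le_div hs).2 hsr.le)
  have key : ((F.filter (‖·‖ < s)).card : ℝ) * Real.log (r / s) ≤
      circleAverage (fun z ↦ Real.log ‖f z‖) 0 r - circleAverage (fun z ↦ Real.log ‖f z‖) 0 s := by
    rw [hA r (hs.trans hsr) le_rfl, hA s hs hsr.le, add_sub_add_right_eq_sub,
      ← Finset.sum_sub_distrib, ← nsmul_eq_mul, ← Finset.sum_const, Finset.sum_filter]
    -- A zero with `‖u‖ < s` contributes its order times exactly `log (r / s)`; every other zero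
    -- contributes a nonnegative amount.
    refine Finset.sum_le_sum fun u hu ↦ ?_
    have hu0 := hne u hu
    rw [← mul_sub]
    split_ifs with hus
    · have h1 : (1 : ℝ) ≤ analyticOrderNatAt f u := by
        exact_mod_cast (analyticOrderNatAt_pos hf h0
          (by simpa using (hus.trans hsr).trans hr)).2 ((hF u).1 hu).2
      rw [max_eq_right (Real.log_nonneg ((one_le_div hu0).2 (hus.trans hsr).le)),
        max_eq_right (Real.log_nonneg ((one_le_div hu0).2 hus.le)),
        Real.log_div (hs.trans hsr).ne' hu0.ne', Real.log_div hs.ne' hu0.ne',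
        Real.log_div (hs.trans hsr).ne' hs.ne'] at *
      nlinarith
    · apply mul_nonneg (by positivity)
      rw [sub_nonneg]
      gcongr
  refine ⟨?_, le_trans (by positivity) key⟩
  rw [hset, encard_toENNReal_mul_ofReal]
  exact ENNReal.ofReal_le_ofReal key

/-- A lower bound for the number of zeros from Jensen's formula, for simple zeros. -/
lemma le_encard_zeros_mul_log (hf : DifferentiableOn ℂ f (ball 0 1)) (h0 : f 0 ≠ 0) {s r : ℝ}
    (hs : 0 < s) (hsr : s < r) (hr : r < 1) (hsimple : ∀ z, ‖z‖ < r → f z = 0 → deriv f z ≠ 0) :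
    ENNReal.ofReal (circleAverage (fun z ↦ Real.log ‖f z‖) 0 r -
        circleAverage (fun z ↦ Real.log ‖f z‖) 0 s) ≤
    (({z : ℂ | ‖z‖ < r ∧ f z = 0}.encard : ℕ∞) : ENNReal) * ENNReal.ofReal (Real.log (r / s)) := by
  classical
  obtain ⟨F, hF, hA⟩ := exists_finset_circleAverage_log hf h0 hr
  have hne : ∀ u ∈ F, 0 < ‖u‖ := fun u hu ↦ by
    rw [norm_pos_iff]
    rintro rfl
    exact h0 ((hF 0).1 hu).2
  have hset : {z : ℂ | ‖z‖ < r ∧ f z = 0} = ((F.filter (‖·‖ < r) : Finset ℂ) : Set ℂ) := by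
    ext z
    simp only [Set.mem_ofPred_eq, Finset.coe_filter, hF]
    constructor
    · rintro ⟨h1, h2⟩
      exact ⟨⟨h1.le, h2⟩, h1⟩
    · rintro ⟨⟨_, h2⟩, h1⟩
      exact ⟨h1, h2⟩
  have hlog : 0 ≤ Real.log (r / s) := Real.log_nonneg ((one_le_div hs).2 hsr.le)
  have key : circleAverage (fun z ↦ Real.log ‖f z‖) 0 r - circleAverage (fun z ↦ Real.log ‖f z‖) 0 s
      ≤ ((F.filter (‖·‖ < r)).card : ℝ) * Real.log (r / s) := by
    rw [hA r (hs.trans hsr) le_rfl, hA s hs hsr.le, add_sub_add_right_eq_sub,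
      ← Finset.sum_sub_distrib, ← nsmul_eq_mul, ← Finset.sum_const, Finset.sum_filter]
    refine Finset.sum_le_sum fun u hu ↦ ?_
    have hu0 := hne u hu
    rw [← mul_sub]
    split_ifs with hur
    -- Multiplicity is not counted on the right, so the order must be one.
    · have h1 : analyticOrderNatAt f u = 1 := by
        have hfu := ((hF u).1 hu).2
        have han := (hf.analyticOnNhd isOpen_ball) u (by simpa using hur.trans hr)
        rw [analyticOrderNatAt, han.analyticOrderAt_eq_one_of_zero_deriv_ne_zero hfu
          (hsimple u hur hfu)]
        rfl
      rw [h1, Nat.cast_one, one_mul, max_eq_right (Real.log_nonneg ((one_le_div hu0).2 hur.le)),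
        Real.log_div (hs.trans hsr).ne' hs.ne', Real.log_div (hs.trans hsr).ne' hu0.ne']
      have := le_max_right 0 (Real.log (s / ‖u‖))
      rw [Real.log_div hs.ne' hu0.ne'] at *
      linarith
    -- Zeros on the circle itself add nothing to Jensen's sum, so the open disk suffices.
    · have hur' : ‖u‖ = r := le_antisymm ((hF u).1 hu).1 (not_lt.1 hur)
      rw [hur', div_self (hs.trans hsr).ne', Real.log_one, max_self, zero_sub]
      exact mul_nonpos_of_nonneg_of_nonpos (by positivity) (by simp)
  rw [hset, encard_toENNReal_mul_ofReal]
  exact ENNReal.ofReal_le_ofReal key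

end Jensen

section Differentiability
open Metric

lemma differentiableOn_powerSeries {Ω : Type*} {ξ : ℤ → Ω → ℂ} {ω : Ω}
    (h : ∀ s : ℝ, 0 ≤ s → s < 1 → Summable fun k : ℕ ↦ ‖ξ k ω‖ * s ^ k) :
    DifferentiableOn ℂ (powerSeries ξ ω) (ball 0 1) := by
  intro z hz
  rw [mem_ball_zero_iff] at hz
  obtain ⟨s, hzs, hs1⟩ := exists_between hz
  have hs0 : 0 ≤ s := (norm_nonneg z).trans hzs.le
  have : DifferentiableOn ℂ (fun w ↦ ∑' k : ℕ, ξ k ω * w ^ k) (ball 0 s) := by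
    refine Complex.differentiableOn_tsum_of_summable_norm (h s hs0 hs1)
      (fun k ↦ by fun_prop) isOpen_ball fun k w hw ↦ ?_
    rw [mem_ball_zero_iff] at hw
    rw [norm_mul, norm_pow]
    gcongr
  exact ((this z (by simpa using hzs)).differentiableAt
    (isOpen_ball.mem_nhds (by simpa using hzs))).differentiableWithinAt

end Differentiability
end TwoDependentGAF

/-! ### Almost sure simplicity of the zeros; positivity of the kernel -/

namespace TwoDependentGAF
section SimpleZeros
open Metric

/-- A function is quadratically small near a double zero, uniformly on compact subdisks. -/
lemma exists_norm_le_mul_sq_of_double_zero {f : ℂ → ℂ} (hf : DifferentiableOn ℂ f (ball 0 1))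
    {ρ : ℝ} (hρ : ρ < 1) : ∃ M : ℝ, 0 ≤ M ∧ ∀ z ∈ closedBall (0 : ℂ) ρ, f z = 0 → deriv f z = 0 →
      ∀ c ∈ closedBall (0 : ℂ) ρ, ‖f c‖ ≤ M * ‖c - z‖ ^ 2 := by
  have hsub : closedBall (0 : ℂ) ρ ⊆ ball 0 1 := closedBall_subset_ball hρ
  have hf1 := hf.deriv isOpen_ball
  have hf2 := (hf1.deriv isOpen_ball).continuousOn.mono hsub
  obtain ⟨M, hM⟩ := (isCompact_closedBall (0 : ℂ) ρ).exists_bound_of_continuousOn hf2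
  refine ⟨max M 0, le_max_right _ _, fun z hz hz0 hz1 c hc ↦ ?_⟩
  have hd : ∀ w ∈ closedBall (0 : ℂ) ρ, ‖deriv f w‖ ≤ max M 0 * ‖w - z‖ := by
    intro w hw
    have := Convex.norm_image_sub_le_of_norm_deriv_le (f := deriv f) (C := max M 0)
      (fun x hx ↦ (hf1 x (hsub hx)).differentiableAt (isOpen_ball.mem_nhds (hsub hx)))
      (fun x hx ↦ (hM x hx).trans (le_max_left _ _)) (convex_closedBall 0 ρ) hz hw
    rwa [hz1, sub_zero] at this
  -- Intersecting with the ball of radius `‖c - z‖` about `z` keeps the set convex and turns the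
  -- linear bound on `f'` into a constant one.
  have := Convex.norm_image_sub_le_of_norm_deriv_le (f := f) (C := max M 0 * ‖c - z‖)
    (s := closedBall 0 ρ ∩ closedBall z ‖c - z‖)
    (fun x hx ↦ (hf x (hsub hx.1)).differentiableAt (isOpen_ball.mem_nhds (hsub hx.1)))
    (fun x hx ↦ (hd x hx.1).trans (by
      have := mem_closedBall_iff_norm.1 hx.2
      gcongr))
    ((convex_closedBall 0 ρ).inter (convex_closedBall z _))
    (x := z) (y := c) ⟨hz, by simp⟩ ⟨hc, by simp [dist_eq_norm]⟩
  rw [hz0, sub_zero] at this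
  linarith

/-- The points `(j + i k) / n` of a square grid. -/
noncomputable def gridPoint (n : ℕ) (p : ℤ × ℤ) : ℂ := ⟨p.1 / n, p.2 / n⟩

lemma exists_gridPoint {n : ℕ} (hn : 0 < n) {z : ℂ} (hz : ‖z‖ < 1) :
    ∃ p ∈ Finset.Icc (-(n : ℤ)) n ×ˢ Finset.Icc (-(n : ℤ)) n, ‖gridPoint n p - z‖ ≤ 2 / n := by
  have hn' : (0 : ℝ) < n := by exact_mod_cast hn
  have hcoord : ∀ x : ℝ, |x| < 1 → ⌊x * n⌋ ∈ Finset.Icc (-(n : ℤ)) n ∧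
      |(⌊x * n⌋ : ℝ) / n - x| ≤ 1 / n := by
    intro x hx
    have hx' := abs_lt.1 hx
    rw [Finset.mem_Icc]
    refine ⟨⟨Int.le_floor.2 ?_, ?_⟩, ?_⟩
    · push_cast
      nlinarith
    · have : ⌊x * n⌋ < (n : ℤ) + 1 := Int.floor_lt.2 (by push_cast; nlinarith)
      omega
    · have e : (⌊x * n⌋ : ℝ) / n - x = (⌊x * n⌋ - x * n) / n := by field_simp
      rw [e, abs_div, abs_of_pos hn']
      gcongr
      rw [abs_le]
      constructor <;> linarith [Int.floor_le (x * n), Int.lt_floor_add_one (x * n)]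
  obtain ⟨h1, h2⟩ := hcoord z.re ((Complex.abs_re_le_norm z).trans_lt hz)
  obtain ⟨h3, h4⟩ := hcoord z.im ((Complex.abs_im_le_norm z).trans_lt hz)
  refine ⟨(⌊z.re * n⌋, ⌊z.im * n⌋), Finset.mem_product.2 ⟨h1, h3⟩, ?_⟩
  refine (Complex.norm_le_abs_re_add_abs_im _).trans ?_
  simp only [gridPoint, Complex.sub_re, Complex.sub_im]
  calc _ ≤ 1 / (n : ℝ) + 1 / n := add_le_add h2 h4
    _ = 2 / n := by ring

variable {Ω : Type*} [MeasurableSpace Ω] {P : Measure Ω} [IsProbabilityMeasure P]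
  {ξ : ℤ → Ω → ℂ} {a b : ℝ}

lemma continuousOn_kernel (a b : ℝ) : ContinuousOn (kernel a b) (ball 0 1) := by
  unfold kernel harm
  refine ContinuousOn.div (by fun_prop) (by fun_prop) fun z hz ↦ ?_
  rw [mem_ball_zero_iff] at hz
  nlinarith [norm_nonneg z]

/-- A double zero makes `|f|` of order `n⁻²` at some point of the grid of mesh `1 / n`. Each grid
point does this with probability `O(n⁻⁴)`, and there are `O(n²)` of them, so the union bound is
`O(n⁻²)`. Countably many radii and constants `m` cover all cases. -/
lemma IsStationaryComplexGaussian.ae_simple_zeros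
    (h : IsStationaryComplexGaussian P ξ (gamma a b)) (hK : ∀ z : ℂ, ‖z‖ < 1 → 0 < kernel a b z) :
    ∀ᵐ ω ∂P, ∀ z : ℂ, ‖z‖ < 1 → powerSeries ξ ω z = 0 → deriv (powerSeries ξ ω) z ≠ 0 := by
  classical
  have key : ∀ ρ : ℝ, 0 ≤ ρ → ρ < 1 → ∀ m : ℕ, P {ω | (∃ z, ‖z‖ < ρ ∧ powerSeries ξ ω z = 0 ∧
      ∀ c ∈ closedBall (0 : ℂ) ((1 + ρ) / 2), ‖powerSeries ξ ω c‖ ≤ m * ‖c - z‖ ^ 2)} = 0 := by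
    intro ρ hρ0 hρ m
    -- The radius `(1 + ρ) / 2` leaves room for a grid point near a zero of modulus below `ρ`.
    have hρ' : (1 + ρ) / 2 < 1 := by linarith
    obtain ⟨c₀, hc₀, hmin⟩ := (isCompact_closedBall (0 : ℂ) ((1 + ρ) / 2)).exists_isMinOn
      ⟨0, by simp; linarith⟩ ((continuousOn_kernel a b).mono (closedBall_subset_ball hρ'))
    set κ := kernel a b c₀ with hκ
    have hκ0 : 0 < κ := hK _ ((mem_closedBall_zero_iff.1 hc₀).trans_lt hρ')
    -- `576 = 9 · 4 · 4²`: at most `9 n²` grid points, the small-ball constant `4`, and `(2 / n)² =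
    -- 4 / n²` squared.
    have hbound : ∀ᶠ n : ℕ in atTop, P {ω | (∃ z, ‖z‖ < ρ ∧ powerSeries ξ ω z = 0 ∧
        ∀ c ∈ closedBall (0 : ℂ) ((1 + ρ) / 2), ‖powerSeries ξ ω c‖ ≤ m * ‖c - z‖ ^ 2)} ≤
        ENNReal.ofReal (576 * m ^ 2 / κ * (1 / (n : ℝ)) ^ 2) := by
      have hsmall : ∀ᶠ n : ℕ in atTop, 2 * (1 / (n : ℝ)) < (1 - ρ) / 2 := by
        have := (tendsto_one_div_atTop_nhds_zero_nat (𝕜 := ℝ)).const_mul 2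
        rw [mul_zero] at this
        exact this.eventually_lt_const (by linarith)
      filter_upwards [hsmall, eventually_gt_atTop 0] with n hn hn0
      have hn0' : (1 : ℝ) ≤ n := by exact_mod_cast hn0
      set I := (Finset.Icc (-(n : ℤ)) n ×ˢ Finset.Icc (-(n : ℤ)) n).filter
        (fun p ↦ gridPoint n p ∈ closedBall (0 : ℂ) ((1 + ρ) / 2)) with hI
      have hcard : (I.card : ℝ) ≤ 9 * n ^ 2 := by
        have h1 : I.card ≤ (2 * n + 1) * (2 * n + 1) := by
          refine (Finset.card_filter_le _ _).trans ?_
          rw [Finset.card_product, Int.card_Icc]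
          have : ((n : ℤ) + 1 - -(n : ℤ)).toNat = 2 * n + 1 := by omega
          rw [this]
        have h2 : (I.card : ℝ) ≤ (2 * n + 1) * (2 * n + 1) := by exact_mod_cast h1
        nlinarith
      calc _ ≤ P (⋃ p ∈ I, {ω | ‖powerSeries ξ ω (gridPoint n p)‖ ≤ m * (2 / n) ^ 2}) := by
            refine measure_mono ?_
            rintro ω ⟨z, hz, -, hc⟩
            obtain ⟨p, hp, hpz⟩ := exists_gridPoint hn0 (hz.trans hρ)
            have hmem : gridPoint n p ∈ closedBall (0 : ℂ) ((1 + ρ) / 2) := by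
              rw [mem_closedBall_zero_iff]
              have h1 : ‖gridPoint n p‖ ≤ ‖gridPoint n p - z‖ + ‖z‖ := by
                simpa using norm_add_le (gridPoint n p - z) z
              have h2 : (2 : ℝ) / n = 2 * (1 / n) := by ring
              linarith
            refine Set.mem_biUnion (Finset.mem_coe.2 (Finset.mem_filter.2 ⟨hp, hmem⟩)) ?_
            refine (hc _ hmem).trans ?_
            gcongr
        _ ≤ ∑ p ∈ I, P {ω | ‖powerSeries ξ ω (gridPoint n p)‖ ≤ m * (2 / n) ^ 2} :=
            measure_biUnion_finset_le _ _
        _ ≤ ∑ p ∈ I, ENNReal.ofReal (4 * (m * (2 / n) ^ 2) ^ 2 / κ) := by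
            refine Finset.sum_le_sum fun p hp ↦ ?_
            have hmem := (Finset.mem_filter.1 hp).2
            have hlt := (mem_closedBall_zero_iff.1 hmem).trans_lt hρ'
            refine (h.measure_powerSeries_le hlt (hK _ hlt) (by positivity)).trans ?_
            refine ENNReal.ofReal_le_ofReal ?_
            gcongr
            exact hmin hmem
        _ = ENNReal.ofReal (I.card * (4 * (m * (2 / n) ^ 2) ^ 2 / κ)) := by
            rw [Finset.sum_const, nsmul_eq_mul, ENNReal.ofReal_mul (by positivity)]
            simp
        _ ≤ ENNReal.ofReal (9 * n ^ 2 * (4 * (m * (2 / n) ^ 2) ^ 2 / κ)) := by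
            refine ENNReal.ofReal_le_ofReal ?_
            gcongr
        _ = _ := by
            congr 1
            field_simp
            ring
    have hlim : Tendsto (fun n : ℕ ↦ ENNReal.ofReal (576 * m ^ 2 / κ * (1 / (n : ℝ)) ^ 2)) atTop
        (𝓝 0) := by
      have := ((tendsto_one_div_atTop_nhds_zero_nat (𝕜 := ℝ)).pow 2).const_mul (576 * m ^ 2 / κ)
      simpa using ENNReal.tendsto_ofReal this
    exact le_antisymm (ge_of_tendsto hlim hbound) zero_le
  have hall : ∀ᵐ ω ∂P, ∀ j m : ℕ, ω ∉ {ω | (∃ z, ‖z‖ < 1 - 1 / ((j : ℝ) + 1) ∧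
      powerSeries ξ ω z = 0 ∧ ∀ c ∈ closedBall (0 : ℂ) ((1 + (1 - 1 / ((j : ℝ) + 1))) / 2),
        ‖powerSeries ξ ω c‖ ≤ m * ‖c - z‖ ^ 2)} := by
    rw [ae_all_iff]
    intro j
    rw [ae_all_iff]
    intro m
    refine measure_eq_zero_iff_ae_notMem.1 (key _ ?_ ?_ m)
    · rw [sub_nonneg, div_le_one (by positivity)]
      linarith [j.cast_nonneg (α := ℝ)]
    · have : (0 : ℝ) < 1 / ((j : ℝ) + 1) := by positivity
      linarith
  filter_upwards [hall, h.ae_summable] with ω hω hsum z hz hz0 hz1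
  obtain ⟨j, hj⟩ := exists_nat_one_div_lt (sub_pos.2 hz)
  have hpos : (0 : ℝ) < 1 / ((j : ℝ) + 1) := by positivity
  obtain ⟨M, hM0, hM⟩ := exists_norm_le_mul_sq_of_double_zero (differentiableOn_powerSeries hsum)
    (ρ := (1 + (1 - 1 / ((j : ℝ) + 1))) / 2) (by linarith)
  obtain ⟨m, hm⟩ := exists_nat_ge M
  refine hω j m ⟨z, by linarith, hz0, fun c hc ↦ ?_⟩
  refine (hM z ?_ hz0 hz1 c hc).trans (by gcongr)
  rw [mem_closedBall_zero_iff]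
  linarith

end SimpleZeros

/-- On `|z| = r`, `h` is the quadratic `4b x² + 2a x + 1 - 2b r²` in `x = Re z`. In the elliptic
part `a² ≤ 4b - 8b²`, and completing the square gives `4b h ≥ 8b² (1 - r²)`. In the triangular part
`|a| ≤ b + 1/2`, and replacing `2a x` by `-(2b + 1)|x|` leaves a polynomial that can be factored. -/
lemma harm_pos {a b : ℝ} (hab : (a, b) ∈ region) {z : ℂ} (hz : ‖z‖ < 1) : 0 < harm a b z := by
  set r := ‖z‖ with hr
  have hr0 : 0 ≤ r := norm_nonneg z
  have hsq : z.re ^ 2 + z.im ^ 2 = r ^ 2 := by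
    rw [hr, ← Complex.normSq_eq_norm_sq, Complex.normSq_apply]; ring
  set x := z.re with hx
  have hh : harm a b z = 4 * b * x ^ 2 + 2 * a * x + (1 - 2 * b * r ^ 2) := by
    rw [harm, sq z, Complex.mul_re, ← hsq]; ring
  rw [hh]
  have hr1 : r ^ 2 < 1 := by nlinarith
  have hxr : |x| ≤ r := Complex.abs_re_le_norm z
  rcases hab with h | ⟨-, h1, h2⟩
  · simp only [region₁, Set.mem_ofPred_eq] at h
    have hb0 : 0 ≤ b := by nlinarith [sq_nonneg a, sq_nonneg b]
    rcases hb0.eq_or_lt with hb | hb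
    · subst hb
      have : a = 0 := by nlinarith [sq_nonneg a]
      subst this
      norm_num
    · have h3 : 0 < 4 * b * (4 * b * x ^ 2 + 2 * a * x + (1 - 2 * b * r ^ 2)) := by
        have : 0 < 8 * b ^ 2 * (1 - r ^ 2) := by
          have : 0 < 1 - r ^ 2 := by linarith
          positivity
        nlinarith [sq_nonneg (4 * b * x + a)]
      exact pos_of_mul_pos_right h3 (by linarith)
  · simp only at h1 h2
    have hax : -(|a| * |x|) ≤ a * x := by
      rw [← abs_mul]; exact neg_abs_le _
    have hx2 : x ^ 2 = |x| ^ 2 := (sq_abs x).symm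
    rw [hx2]
    set t := |x| with ht
    have ht0 : 0 ≤ t := abs_nonneg x
    have ht1 : t < 1 := by nlinarith
    have h5 : |a| * t ≤ (b + 1 / 2) * t := by gcongr; linarith
    rcases le_or_gt 0 b with hb | hb
    -- The lower bound for `h` is this product plus `2b (1 - r²)`; `b ≤ 1/6` makes the second factor
    -- positive.
    · have h6 : 0 < (1 - t) * (1 - 2 * b - 4 * b * t) := by
        apply mul_pos (by linarith)
        nlinarith
      nlinarith [mul_nonneg hb (by linarith : 0 ≤ 1 - r ^ 2)]
    -- The lower bound for `h` is this product plus `-2b (r² - t²)`, nonnegative as `b < 0`.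
    · have h6 : 0 < (1 - t) * (1 - 2 * b * t) := by
        apply mul_pos (by linarith)
        nlinarith
      have h7 : t ^ 2 ≤ r ^ 2 := by gcongr
      nlinarith

lemma kernel_pos {a b : ℝ} (hab : (a, b) ∈ region) {z : ℂ} (hz : ‖z‖ < 1) : 0 < kernel a b z := by
  refine div_pos (harm_pos hab hz) ?_
  nlinarith [norm_nonneg z]

end TwoDependentGAF

/-! ### Expectation of Jensen's formula -/

namespace TwoDependentGAF
section Expectation
open Metric

variable {Ω : Type*} [MeasurableSpace Ω] {P : Measure Ω} [IsProbabilityMeasure P]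
  {ξ : ℤ → Ω → ℂ} {a b : ℝ}

lemma IsStationaryComplexGaussian.aestronglyMeasurable_circleMap
    (h : IsStationaryComplexGaussian P ξ (gamma a b)) {r : ℝ} (hr0 : 0 < r) (hr : r < 1)
    (μ : Measure ℝ) [SFinite μ] :
    AEStronglyMeasurable (fun p : Ω × ℝ ↦ powerSeries ξ p.1 (circleMap 0 r p.2)) (P.prod μ) := by
  have hterm : ∀ n, AEStronglyMeasurable
      (fun p : Ω × ℝ ↦ partialSum ξ (circleMap 0 r p.2) n p.1) (P.prod μ) := fun n ↦ by
    refine Finset.aestronglyMeasurable_fun_sum _ fun k _ ↦ ?_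
    refine AEStronglyMeasurable.mul ?_ ?_
    · exact (h.1.aemeasurable k).aestronglyMeasurable.comp_fst
    · exact (show Continuous fun θ ↦ circleMap 0 r θ ^ k by fun_prop).aestronglyMeasurable.comp_snd
  refine aestronglyMeasurable_of_tendsto_ae atTop hterm ?_
  have : ∀ᵐ p ∂(P.prod μ), ∀ s : ℝ, 0 ≤ s → s < 1 → Summable fun k : ℕ ↦ ‖ξ k p.1‖ * s ^ k :=
    Measure.quasiMeasurePreserving_fst.ae h.ae_summable
  filter_upwards [this] with p hp
  refine (summable_of_summable_norm (c := fun k ↦ ξ k p.1)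
    (hp _ (norm_nonneg _) ?_)).hasSum.tendsto_sum_nat
  simpa [abs_of_pos hr0] using hr

lemma continuous_kernel_circleMap (a b : ℝ) {r : ℝ} (hr0 : 0 < r) (hr : r < 1) :
    Continuous fun θ ↦ kernel a b (circleMap 0 r θ) :=
  (continuousOn_kernel a b).comp_continuous (continuous_circleMap 0 r) fun θ ↦ by
    simpa [abs_of_pos hr0] using hr

/-- Fubini on `Ω` times the circle. It applies because `E |log |f z||` is at most `½ |log K(z)|`
plus a constant, and `log K` is continuous on the circle. -/
lemma IsStationaryComplexGaussian.integrable_and_integral_circleAverage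
    (h : IsStationaryComplexGaussian P ξ (gamma a b)) (hK : ∀ z : ℂ, ‖z‖ < 1 → 0 < kernel a b z)
    {r : ℝ} (hr0 : 0 < r) (hr : r < 1) :
    Integrable (fun ω ↦ Real.circleAverage (fun z ↦ Real.log ‖powerSeries ξ ω z‖) 0 r) P ∧
    ∫ ω, Real.circleAverage (fun z ↦ Real.log ‖powerSeries ξ ω z‖) 0 r ∂P =
      1 / 2 * Real.circleAverage (fun z ↦ Real.log (kernel a b z)) 0 r +
        ∫ ω, Real.log ‖ξ 0 ω‖ ∂P := by
  set μ : Measure ℝ := volume.restrict (Set.Ioc 0 (2 * Real.pi)) with hμ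
  set c := ∫ ω, Real.log ‖ξ 0 ω‖ ∂P with hc
  have hpi : (0 : ℝ) ≤ 2 * Real.pi := by positivity
  have hnorm : ∀ θ, ‖circleMap 0 r θ‖ < 1 := fun θ ↦ by simpa [abs_of_pos hr0] using hr
  have hpos : ∀ θ, 0 < kernel a b (circleMap 0 r θ) := fun θ ↦ hK _ (hnorm θ)
  have hlogc : Continuous fun θ ↦ Real.log (kernel a b (circleMap 0 r θ)) :=
    (continuous_kernel_circleMap a b hr0 hr).log fun θ ↦ (hpos θ).ne'
  have hlogi : Integrable (fun θ ↦ Real.log (kernel a b (circleMap 0 r θ))) μ :=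
    (hlogc.intervalIntegrable 0 (2 * Real.pi)).1
  have hmeas : AEStronglyMeasurable
      (fun p : Ω × ℝ ↦ Real.log ‖powerSeries ξ p.1 (circleMap 0 r p.2)‖) (P.prod μ) :=
    (Real.measurable_log.comp_aemeasurable
      (h.aestronglyMeasurable_circleMap hr0 hr μ).aemeasurable.norm).aestronglyMeasurable
  have hint : Integrable
      (fun p : Ω × ℝ ↦ Real.log ‖powerSeries ξ p.1 (circleMap 0 r p.2)‖) (P.prod μ) := by
    rw [integrable_prod_iff' hmeas]
    refine ⟨ae_of_all _ fun θ ↦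
      (h.integrable_and_integral_comp_norm (hnorm θ) (hpos θ)).1, ?_⟩
    refine Integrable.mono' ((hlogi.abs.const_mul (1 / 2)).add (integrable_const
      (∫ ω, ‖Real.log ‖ξ 0 ω‖‖ ∂P))) hmeas.norm.prod_swap.integral_prod_right' ?_
    refine ae_of_all _ fun θ ↦ ?_
    rw [Real.norm_of_nonneg (integral_nonneg fun _ ↦ norm_nonneg _)]
    exact (h.integrable_and_integral_comp_norm (hnorm θ) (hpos θ)).2.2
  have hA : ∀ ω, Real.circleAverage (fun z ↦ Real.log ‖powerSeries ξ ω z‖) 0 r =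
      (2 * Real.pi)⁻¹ * ∫ θ, Real.log ‖powerSeries ξ ω (circleMap 0 r θ)‖ ∂μ := fun ω ↦ by
    rw [Real.circleAverage_def, intervalIntegral.integral_of_le hpi, smul_eq_mul]
  simp_rw [hA]
  refine ⟨hint.integral_prod_left.const_mul _, ?_⟩
  rw [integral_const_mul, integral_integral_swap hint]
  have hθ : ∀ θ, ∫ ω, Real.log ‖powerSeries ξ ω (circleMap 0 r θ)‖ ∂P =
      1 / 2 * Real.log (kernel a b (circleMap 0 r θ)) + c := fun θ ↦
    (h.integrable_and_integral_comp_norm (hnorm θ) (hpos θ)).2.1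
  simp_rw [hθ]
  rw [integral_add (hlogi.const_mul _) (integrable_const _), integral_const_mul,
    Real.circleAverage_def, intervalIntegral.integral_of_le hpi, smul_eq_mul, ← hμ]
  have : μ.real Set.univ = 2 * Real.pi := by simp [hμ, measureReal_def, Real.pi_nonneg]
  rw [integral_const, this, smul_eq_mul]
  field_simp

/-- The two-sided Jensen bound for the expected number of zeros. -/
lemma IsStationaryComplexGaussian.expectedZeroCount_bounds
    (h : IsStationaryComplexGaussian P ξ (gamma a b)) (hK : ∀ z : ℂ, ‖z‖ < 1 → 0 < kernel a b z)
    {s r : ℝ} (hs : 0 < s) (hsr : s < r) (hr : r < 1) :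
    0 ≤ 1 / 2 * (Real.circleAverage (fun z ↦ Real.log (kernel a b z)) 0 r -
        Real.circleAverage (fun z ↦ Real.log (kernel a b z)) 0 s) ∧
    expectedZeroCount P ξ s * ENNReal.ofReal (Real.log (r / s)) ≤
      ENNReal.ofReal (1 / 2 * (Real.circleAverage (fun z ↦ Real.log (kernel a b z)) 0 r -
        Real.circleAverage (fun z ↦ Real.log (kernel a b z)) 0 s)) ∧
    ENNReal.ofReal (1 / 2 * (Real.circleAverage (fun z ↦ Real.log (kernel a b z)) 0 r -
        Real.circleAverage (fun z ↦ Real.log (kernel a b z)) 0 s)) ≤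
      expectedZeroCount P ξ r * ENNReal.ofReal (Real.log (r / s)) := by
  obtain ⟨hir, her⟩ := h.integrable_and_integral_circleAverage hK (hs.trans hsr) hr
  obtain ⟨his, hes⟩ := h.integrable_and_integral_circleAverage hK hs (hsr.trans hr)
  have hE : ∫ ω, (Real.circleAverage (fun z ↦ Real.log ‖powerSeries ξ ω z‖) 0 r -
      Real.circleAverage (fun z ↦ Real.log ‖powerSeries ξ ω z‖) 0 s) ∂P =
      1 / 2 * (Real.circleAverage (fun z ↦ Real.log (kernel a b z)) 0 r -
        Real.circleAverage (fun z ↦ Real.log (kernel a b z)) 0 s) := by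
    rw [integral_sub hir his, her, hes]
    ring
  have hne := h.ae_powerSeries_ne_zero (z := 0) (by simp) (hK 0 (by simp))
  have hnn : 0 ≤ᵐ[P] fun ω ↦ Real.circleAverage (fun z ↦ Real.log ‖powerSeries ξ ω z‖) 0 r -
      Real.circleAverage (fun z ↦ Real.log ‖powerSeries ξ ω z‖) 0 s := by
    filter_upwards [h.ae_summable, hne] with ω h1 h2
    exact (encard_zeros_mul_log_le (differentiableOn_powerSeries h1) h2 hs hsr hr).2
  have hi : Integrable (fun ω ↦ Real.circleAverage (fun z ↦ Real.log ‖powerSeries ξ ω z‖) 0 r -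
      Real.circleAverage (fun z ↦ Real.log ‖powerSeries ξ ω z‖) 0 s) P := hir.sub his
  rw [← hE]
  refine ⟨integral_nonneg_of_ae hnn, ?_, ?_⟩
  · rw [ofReal_integral_eq_lintegral_ofReal hi hnn, expectedZeroCount,
      ← lintegral_mul_const' _ _ ENNReal.ofReal_ne_top]
    refine lintegral_mono_ae ?_
    filter_upwards [h.ae_summable, hne] with ω h1 h2
    exact (encard_zeros_mul_log_le (differentiableOn_powerSeries h1) h2 hs hsr hr).1
  · rw [ofReal_integral_eq_lintegral_ofReal hi hnn, expectedZeroCount,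
      ← lintegral_mul_const' _ _ ENNReal.ofReal_ne_top]
    refine lintegral_mono_ae ?_
    filter_upwards [h.ae_summable, hne, h.ae_simple_zeros hK] with ω h1 h2 h3
    exact le_encard_zeros_mul_log (differentiableOn_powerSeries h1) h2 hs hsr hr
      fun z hz ↦ h3 z (hz.trans hr)

/-- The expected number of zeros as a radial derivative. -/
lemma IsStationaryComplexGaussian.expectedZeroCount_eq_of_hasDerivAt
    (h : IsStationaryComplexGaussian P ξ (gamma a b)) (hK : ∀ z : ℂ, ‖z‖ < 1 → 0 < kernel a b z)
    {r L' : ℝ} (hr0 : 0 < r) (hr : r < 1)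
    (hL : HasDerivAt (fun s ↦ Real.circleAverage (fun z ↦ Real.log (kernel a b z)) 0 s) L' r) :
    expectedZeroCount P ξ r = ENNReal.ofReal (r / 2 * L') ∧ 0 ≤ r / 2 * L' := by
  set L := fun s ↦ Real.circleAverage (fun z ↦ Real.log (kernel a b z)) 0 s with hLdef
  -- `q` is half the slope of `L` divided by the slope of `log`, whence its limit `r L' / 2`.
  -- Approaching `r` from the right uses the upper Jensen bound, from the left the lower one.
  set q : ℝ → ℝ := fun t ↦ 1 / 2 * (L t - L r) / Real.log (t / r) with hqdef
  have hq : ∀ t, q t = 1 / 2 * (L t - L r) / Real.log (t / r) := fun _ ↦ rfl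
  have hlim : Tendsto q (𝓝[≠] r) (𝓝 (r / 2 * L')) := by
    have h1 := hasDerivAt_iff_tendsto_slope.1 hL
    have h2 := hasDerivAt_iff_tendsto_slope.1 (Real.hasDerivAt_log hr0.ne')
    have h3 := (h1.div h2 (inv_ne_zero hr0.ne')).const_mul (1 / 2)
    have e : 1 / 2 * (L' / r⁻¹) = r / 2 * L' := by field_simp
    rw [e] at h3
    refine h3.congr' ?_
    have hpos : ∀ᶠ t in 𝓝[≠] r, 0 < t := nhdsWithin_le_nhds (lt_mem_nhds hr0)
    filter_upwards [self_mem_nhdsWithin, hpos] with t ht htp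
    have : t - r ≠ 0 := sub_ne_zero.2 ht
    rw [hq, Pi.div_apply, slope_def_field, slope_def_field, Real.log_div htp.ne' hr0.ne']
    field_simp
  have hright : Tendsto q (𝓝[>] r) (𝓝 (r / 2 * L')) :=
    hlim.mono_left (nhdsWithin_mono _ fun t (ht : r < t) ↦ ht.ne')
  have hleft : Tendsto q (𝓝[<] r) (𝓝 (r / 2 * L')) :=
    hlim.mono_left (nhdsWithin_mono _ fun t (ht : t < r) ↦ ht.ne)
  refine ⟨le_antisymm ?_ ?_, ?_⟩
  · refine ge_of_tendsto (ENNReal.tendsto_ofReal hright) ?_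
    filter_upwards [Ioo_mem_nhdsGT hr] with t ht
    have hlog : 0 < Real.log (t / r) := Real.log_pos ((one_lt_div hr0).2 ht.1)
    rw [hq, ENNReal.ofReal_div_of_pos hlog, ENNReal.le_div_iff_mul_le
      (Or.inl (by simpa using hlog)) (Or.inl ENNReal.ofReal_ne_top)]
    exact (h.expectedZeroCount_bounds hK hr0 ht.1 ht.2).2.1
  · refine le_of_tendsto (ENNReal.tendsto_ofReal hleft) ?_
    filter_upwards [Ioo_mem_nhdsLT hr0] with t ht
    have hlog : 0 < Real.log (r / t) := Real.log_pos ((one_lt_div ht.1).2 ht.2)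
    have hqt : q t = 1 / 2 * (L r - L t) / Real.log (r / t) := by
      rw [hq, Real.log_div ht.1.ne' hr0.ne', Real.log_div hr0.ne' ht.1.ne', ← neg_sub (L r),
        ← neg_sub (Real.log r), mul_neg, neg_div_neg_eq]
    rw [hqt, ENNReal.ofReal_div_of_pos hlog]
    exact ENNReal.div_le_of_le_mul (h.expectedZeroCount_bounds hK ht.1 ht.2 hr).2.2
  · refine ge_of_tendsto hright ?_
    filter_upwards [Ioo_mem_nhdsGT hr] with t ht
    have hlog : 0 < Real.log (t / r) := Real.log_pos ((one_lt_div hr0).2 ht.1)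
    exact div_nonneg (h.expectedZeroCount_bounds hK hr0 ht.1 ht.2).1 hlog.le

end Expectation
end TwoDependentGAF

/-! ### The radial derivative and the excess -/

namespace TwoDependentGAF

/-- Differentiation under the integral sign for functions that are continuously differentiable in
the parameter. -/
lemma hasDerivAt_integral_of_continuousOn {G G' : ℝ → ℝ → ℝ} {V : Set (ℝ × ℝ)} {T r₀ : ℝ}
    (hT : 0 ≤ T) (hV : IsOpen V) (hr₀ : ∀ θ, (r₀, θ) ∈ V)
    (hG : ContinuousOn (fun p : ℝ × ℝ ↦ G p.1 p.2) V)
    (hG' : ContinuousOn (fun p : ℝ × ℝ ↦ G' p.1 p.2) V)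
    (hd : ∀ p ∈ V, HasDerivAt (fun r ↦ G r p.2) (G' p.1 p.2) p.1) :
    HasDerivAt (fun r ↦ ∫ θ in 0..T, G r θ) (∫ θ in 0..T, G' r₀ θ) r₀ := by
  have hc : Continuous fun θ ↦ G' r₀ θ :=
    hG'.comp_continuous (f := fun θ ↦ (r₀, θ)) (by fun_prop) hr₀
  obtain ⟨M, hM⟩ := (isCompact_Icc (a := 0) (b := T)).exists_bound_of_continuousOn hc.continuousOn
  -- Tube lemma: compactness of `[0, T]` makes the neighbourhood of `r₀` uniform in `θ`.
  have hev : ∀ᶠ r in 𝓝 r₀, ∀ θ ∈ Set.Icc 0 T, (r, θ) ∈ V ∧ ‖G' r θ‖ ≤ M + 1 := by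
    refine isCompact_Icc.eventually_forall_of_forall_eventually fun θ hθ ↦ ?_
    have h1 : ∀ᶠ p in 𝓝 (r₀, θ), p ∈ V := hV.mem_nhds (hr₀ θ)
    have h2 : ∀ᶠ p in 𝓝 (r₀, θ), ‖G' p.1 p.2‖ < M + 1 :=
      (hG'.continuousAt (hV.mem_nhds (hr₀ θ))).norm.eventually_lt_const
        ((hM θ hθ).trans_lt (lt_add_one M))
    filter_upwards [h1, h2] with p hp1 hp2 using ⟨hp1, hp2.le⟩
  have huI : Set.uIoc 0 T ⊆ Set.Icc 0 T := by
    rw [Set.uIoc_of_le hT]; exact Set.Ioc_subset_Icc_self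
  have hcr : ∀ r, (∀ θ ∈ Set.Icc 0 T, (r, θ) ∈ V) → ContinuousOn (G r) (Set.Icc 0 T) :=
    fun r hr ↦ hG.comp (f := fun θ ↦ (r, θ)) (by fun_prop) hr
  refine (intervalIntegral.hasDerivAt_integral_of_dominated_loc_of_deriv_le
    (bound := fun _ ↦ M + 1) hev ?_ ?_ hc.aestronglyMeasurable ?_ (by simp) ?_).2
  · filter_upwards [hev] with r hr
    exact ((hcr r fun θ hθ ↦ (hr θ hθ).1).mono huI).aestronglyMeasurable measurableSet_uIoc
  · refine ContinuousOn.intervalIntegrable ?_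
    rw [Set.uIcc_of_le hT]
    exact hcr r₀ fun θ _ ↦ hr₀ θ
  · exact ae_of_all _ fun θ hθ r hr ↦ (hr θ (huI hθ)).2
  · exact ae_of_all _ fun θ hθ r hr ↦ hd (r, θ) (hr θ (huI hθ)).1

/-- `harm` in polar coordinates. -/
noncomputable def harmPolar (a b r θ : ℝ) : ℝ :=
  1 + 2 * a * (r * Real.cos θ) + 2 * b * (r ^ 2 * Real.cos (2 * θ))

lemma circleMap_re (r θ : ℝ) : (circleMap 0 r θ).re = r * Real.cos θ := by
  simp [circleMap, Complex.exp_ofReal_mul_I_re]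

lemma circleMap_sq_re (r θ : ℝ) : (circleMap 0 r θ ^ 2).re = r ^ 2 * Real.cos (2 * θ) := by
  have : circleMap 0 r θ ^ 2 = ((r ^ 2 : ℝ) : ℂ) * Complex.exp (((2 * θ : ℝ) : ℂ) * Complex.I) := by
    rw [circleMap, zero_add, mul_pow, ← Complex.exp_nat_mul]
    push_cast
    ring_nf
  rw [this, Complex.re_ofReal_mul, Complex.exp_ofReal_mul_I_re]

lemma harm_circleMap (a b r θ : ℝ) : harm a b (circleMap 0 r θ) = harmPolar a b r θ := by
  rw [harm, circleMap_re, circleMap_sq_re, harmPolar]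

/-- The difference between `E N(r)` and its value `r ^ 2 / (1 - r ^ 2)` in the independent case. -/
noncomputable def excess (a b r : ℝ) : ℝ :=
  Real.circleAverage (fun z ↦ 1 - (1 + a * z.re) / harm a b z) 0 r

/-- Half the radial derivative of `harm`, multiplied by the radius. -/
noncomputable def radialPart (a b r θ : ℝ) : ℝ :=
  a * (r * Real.cos θ) + 2 * b * (r ^ 2 * Real.cos (2 * θ))

/-- The conjugate function of `radialPart`. -/
noncomputable def angularPart (a b r θ : ℝ) : ℝ :=
  a * (r * Real.sin θ) + 2 * b * (r ^ 2 * Real.sin (2 * θ))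

lemma excess_eq {a b r : ℝ} (h : ∀ θ ∈ Set.Icc 0 (2 * Real.pi), 0 < harmPolar a b r θ) :
    excess a b r = (2 * Real.pi)⁻¹ *
      ∫ θ in 0..2 * Real.pi, radialPart a b r θ / harmPolar a b r θ := by
  rw [excess, Real.circleAverage_def, smul_eq_mul]
  congr 1
  refine intervalIntegral.integral_congr fun θ hθ ↦ ?_
  rw [Set.uIcc_of_le Real.two_pi_pos.le] at hθ
  simp only [harm_circleMap, circleMap_re]
  have := (h θ hθ).ne'
  field_simp
  rw [harmPolar, radialPart]
  ring

lemma isOpen_harmPolar_pos (a b : ℝ) : IsOpen {p : ℝ × ℝ | 0 < harmPolar a b p.1 p.2} := by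
  unfold harmPolar
  exact isOpen_lt (by fun_prop) (by fun_prop)

lemma hasDerivAt_harmPolar (a b r θ : ℝ) : HasDerivAt (fun s ↦ harmPolar a b s θ)
    (2 * a * Real.cos θ + 4 * b * (r * Real.cos (2 * θ))) r := by
  have h1 := ((hasDerivAt_id r).mul_const (Real.cos θ)).const_mul (2 * a)
  have h2 := (((hasDerivAt_id r).pow 2).mul_const (Real.cos (2 * θ))).const_mul (2 * b)
  have h := (h1.const_add 1).add h2
  exact h.congr_deriv (by simp; ring)

/-- `log K = log h - log (1 - |z|²)`; the second term is constant on circles and yields `r² / (1 -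
r²)`. -/
lemma hasDerivAt_circleAverage_log_kernel {a b : ℝ} (hab : (a, b) ∈ region) {r : ℝ} (hr0 : 0 < r)
    (hr : r < 1) : HasDerivAt (fun s ↦ Real.circleAverage (fun z ↦ Real.log (kernel a b z)) 0 s)
      (2 / r * (r ^ 2 / (1 - r ^ 2) + excess a b r)) r := by
  have hpos : ∀ s, 0 < s → s < 1 → ∀ θ, 0 < harmPolar a b s θ := fun s h0 h1 θ ↦ by
    rw [← harm_circleMap]
    exact harm_pos hab (by simpa [abs_of_pos h0] using h1)
  have hlt : ∀ s : ℝ, 0 < s → s < 1 → 0 < 1 - s ^ 2 := fun s h0 h1 ↦ by nlinarith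
  have hH := (hasDerivAt_integral_of_continuousOn (T := 2 * Real.pi) (r₀ := r)
    (G := fun s θ ↦ Real.log (harmPolar a b s θ))
    (G' := fun s θ ↦ (2 * a * Real.cos θ + 4 * b * (s * Real.cos (2 * θ))) / harmPolar a b s θ)
    (by positivity) (isOpen_harmPolar_pos a b) (hpos r hr0 hr)
    (ContinuousOn.log (by unfold harmPolar; fun_prop) fun p hp ↦
      (show 0 < harmPolar a b p.1 p.2 from hp).ne')
    (ContinuousOn.div (by fun_prop) (by unfold harmPolar; fun_prop) fun p hp ↦
      (show 0 < harmPolar a b p.1 p.2 from hp).ne')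
    fun p hp ↦ (hasDerivAt_harmPolar a b p.1 p.2).log
      (show 0 < harmPolar a b p.1 p.2 from hp).ne').const_mul (2 * Real.pi)⁻¹
  have hl : HasDerivAt (fun s : ℝ ↦ Real.log (1 - s ^ 2)) (-(2 * r) / (1 - r ^ 2)) r := by
    have := (((hasDerivAt_id r).pow 2).const_sub 1).log (hlt r hr0 hr).ne'
    simpa using this
  have hsub := hH.sub hl
  refine (hsub.congr_deriv ?_).congr_of_eventuallyEq ?_
  · rw [excess_eq fun θ _ ↦ hpos r hr0 hr θ]
    have e : ∀ θ, (2 * a * Real.cos θ + 4 * b * (r * Real.cos (2 * θ))) / harmPolar a b r θ =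
        2 / r * (radialPart a b r θ / harmPolar a b r θ) := fun θ ↦ by
      have := (hpos r hr0 hr θ).ne'
      rw [radialPart]
      field_simp
      ring
    simp_rw [e]
    rw [intervalIntegral.integral_const_mul]
    have := (hlt r hr0 hr).ne'
    field_simp
    ring
  · filter_upwards [Ioo_mem_nhds hr0 hr] with s hs
    have hs' := hpos s hs.1 hs.2
    rw [Pi.sub_apply, Real.circleAverage_def, smul_eq_mul]
    have e : ∀ θ, Real.log (kernel a b (circleMap 0 s θ)) =
        Real.log (harmPolar a b s θ) - Real.log (1 - s ^ 2) := fun θ ↦ by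
      rw [kernel, harm_circleMap, norm_circleMap_zero, sq_abs,
        Real.log_div (hs' θ).ne' (hlt s hs.1 hs.2).ne']
    simp_rw [e]
    rw [intervalIntegral.integral_sub, intervalIntegral.integral_const]
    · simp only [sub_zero, smul_eq_mul]
      field_simp
    · refine Continuous.intervalIntegrable ?_ _ _
      exact Continuous.log (by unfold harmPolar; fun_prop) fun θ ↦ (hs' θ).ne'
    · simp

/-- The Edelman–Kostlan formula for the expected number of zeros. -/
theorem IsStationaryComplexGaussian.expectedZeroCount_eq {Ω : Type*} [MeasurableSpace Ω]
    {P : Measure Ω} [IsProbabilityMeasure P] {ξ : ℤ → Ω → ℂ} {a b : ℝ} (hab : (a, b) ∈ region)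
    (h : IsStationaryComplexGaussian P ξ (gamma a b)) {r : ℝ} (hr0 : 0 < r) (hr : r < 1) :
    expectedZeroCount P ξ r = ENNReal.ofReal (r ^ 2 / (1 - r ^ 2) + excess a b r) ∧
      (expectedZeroCount P ξ r).toReal = r ^ 2 / (1 - r ^ 2) + excess a b r := by
  obtain ⟨h1, h2⟩ := h.expectedZeroCount_eq_of_hasDerivAt (fun z hz ↦ kernel_pos hab hz) hr0 hr
    (hasDerivAt_circleAverage_log_kernel hab hr0 hr)
  have e : r / 2 * (2 / r * (r ^ 2 / (1 - r ^ 2) + excess a b r)) =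
      r ^ 2 / (1 - r ^ 2) + excess a b r := by
    rw [← mul_assoc, div_mul_div_cancel₀' hr0.ne', div_self two_ne_zero, one_mul]
  rw [e] at h1 h2
  exact ⟨h1, by rw [h1, ENNReal.toReal_ofReal h2]⟩

/-! ### Monotonicity of the excess -/

/-- Positivity is required only at the radius `r` itself, so that `r = 1` is allowed for interior
parameters. -/
lemma hasDerivAt_excess {a b r : ℝ} (h : ∀ θ, 0 < harmPolar a b r θ) :
    HasDerivAt (fun s ↦ excess a b s) ((2 * Real.pi)⁻¹ * ∫ θ in 0..2 * Real.pi,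
      ((a * Real.cos θ + 4 * b * (r * Real.cos (2 * θ))) * harmPolar a b r θ - radialPart a b r θ *
        (2 * a * Real.cos θ + 4 * b * (r * Real.cos (2 * θ)))) / harmPolar a b r θ ^ 2) r := by
  have hN : ∀ s θ, HasDerivAt (fun s ↦ radialPart a b s θ)
      (a * Real.cos θ + 4 * b * (s * Real.cos (2 * θ))) s := fun s θ ↦ by
    have h1 := ((hasDerivAt_id s).mul_const (Real.cos θ)).const_mul a
    have h2 := (((hasDerivAt_id s).pow 2).mul_const (Real.cos (2 * θ))).const_mul (2 * b)
    have h := h1.add h2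
    exact h.congr_deriv (by simp; ring)
  have hH := (hasDerivAt_integral_of_continuousOn (T := 2 * Real.pi) (r₀ := r)
    (G := fun s θ ↦ radialPart a b s θ / harmPolar a b s θ)
    (G' := fun r θ ↦ ((a * Real.cos θ + 4 * b * (r * Real.cos (2 * θ))) * harmPolar a b r θ -
      radialPart a b r θ * (2 * a * Real.cos θ + 4 * b * (r * Real.cos (2 * θ)))) /
        harmPolar a b r θ ^ 2)
    (by positivity) (isOpen_harmPolar_pos a b) h
    (ContinuousOn.div (by unfold radialPart; fun_prop) (by unfold harmPolar; fun_prop)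
      fun p hp ↦
      (show 0 < harmPolar a b p.1 p.2 from hp).ne')
    (ContinuousOn.div (by unfold harmPolar radialPart; fun_prop) (by unfold harmPolar; fun_prop)
      fun p hp ↦
      (pow_pos (show 0 < harmPolar a b p.1 p.2 from hp) 2).ne')
    fun p hp ↦ (hN p.1 p.2).div (hasDerivAt_harmPolar a b p.1 p.2)
      (show 0 < harmPolar a b p.1 p.2 from hp).ne').const_mul
      (2 * Real.pi)⁻¹
  refine hH.congr_of_eventuallyEq ?_
  have hev : ∀ᶠ s in 𝓝 r, ∀ θ ∈ Set.Icc 0 (2 * Real.pi), 0 < harmPolar a b s θ :=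
    isCompact_Icc.eventually_forall_of_forall_eventually fun θ _ ↦
      (isOpen_harmPolar_pos a b).mem_nhds (h θ)
  filter_upwards [hev] with s hs using excess_eq hs

lemma continuous_radialPart (a b r : ℝ) : Continuous (radialPart a b r) := by
  unfold radialPart; fun_prop

lemma continuous_angularPart (a b r : ℝ) : Continuous (angularPart a b r) := by
  unfold angularPart; fun_prop

lemma continuous_harmPolar (a b r : ℝ) : Continuous (harmPolar a b r) := by
  unfold harmPolar; fun_prop

/-- An exact `θ`-derivative has zero integral over the circle; this one trades the second
derivatives of `h` for squares of first ones. -/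
lemma hasDerivAt_angularPart_div {a b r : ℝ} (h : ∀ θ, 0 < harmPolar a b r θ) (θ : ℝ) :
    HasDerivAt (fun t ↦ angularPart a b r t / harmPolar a b r t)
      ((a * (r * Real.cos θ) + 4 * b * (r ^ 2 * Real.cos (2 * θ))) / harmPolar a b r θ +
        2 * angularPart a b r θ ^ 2 / harmPolar a b r θ ^ 2) θ := by
  have h2θ : HasDerivAt (fun t : ℝ ↦ 2 * t) 2 θ := by
    simpa using (hasDerivAt_id θ).const_mul 2
  have hS : HasDerivAt (angularPart a b r)
      (a * (r * Real.cos θ) + 4 * b * (r ^ 2 * Real.cos (2 * θ))) θ := by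
    have h1 := ((Real.hasDerivAt_sin θ).const_mul r).const_mul a
    have h2 := ((h2θ.sin).const_mul (r ^ 2)).const_mul (2 * b)
    exact (h1.add h2).congr_deriv (by ring)
  have hH : HasDerivAt (harmPolar a b r) (-2 * angularPart a b r θ) θ := by
    have h1 := ((Real.hasDerivAt_cos θ).const_mul r).const_mul (2 * a)
    have h2 := ((h2θ.cos).const_mul (r ^ 2)).const_mul (2 * b)
    exact ((h1.const_add 1).add h2).congr_deriv (by rw [angularPart]; ring)
  refine (hS.div hH (h θ).ne').congr_deriv ?_
  have := (h θ).ne'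
  field_simp
  ring

/-- The identity `Δ log h = -|∇h|² / h²` for harmonic `h`, averaged over the circle. With `N =
radialPart` and `S = angularPart`, the real and imaginary parts of `a z + 2b z²`, it says that `r`
times the derivative is the average of `-2 (N² + S²) / h²`. -/
lemma deriv_excess_neg {a b r : ℝ} (hab : (a, b) ≠ (0, 0)) (hr : 0 < r)
    (h : ∀ θ, 0 < harmPolar a b r θ) : deriv (excess a b) r < 0 := by
  have hpi := Real.two_pi_pos
  have hne : ∀ θ, harmPolar a b r θ ≠ 0 := fun θ ↦ (h θ).ne'
  rw [(hasDerivAt_excess h).deriv]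
  have hcH := continuous_harmPolar a b r
  have hcS := continuous_angularPart a b r
  have hcN := continuous_radialPart a b r
  set D : ℝ → ℝ := fun θ ↦
    (a * (r * Real.cos θ) + 4 * b * (r ^ 2 * Real.cos (2 * θ))) / harmPolar a b r θ +
        2 * angularPart a b r θ ^ 2 / harmPolar a b r θ ^ 2 with hD
  set Q : ℝ → ℝ := fun θ ↦
    (radialPart a b r θ ^ 2 + angularPart a b r θ ^ 2) / harmPolar a b r θ ^ 2 with hQ
  have hcD : Continuous D :=
    (Continuous.div (by fun_prop) hcH hne).add
      (Continuous.div (by fun_prop) (by fun_prop) fun θ ↦ pow_ne_zero 2 (hne θ))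
  have hcQ : Continuous Q :=
    Continuous.div (by fun_prop) (by fun_prop) fun θ ↦ pow_ne_zero 2 (hne θ)
  have hD0 : ∫ θ in 0..2 * Real.pi, D θ = 0 := by
    rw [intervalIntegral.integral_eq_sub_of_hasDerivAt
      (fun θ _ ↦ hasDerivAt_angularPart_div h θ) (hcD.intervalIntegrable _ _)]
    have hs : Real.sin (2 * (2 * Real.pi)) = 0 := by
      rw [show 2 * (2 * Real.pi) = 2 * Real.pi + 2 * Real.pi by ring, Real.sin_add_two_pi,
        Real.sin_two_pi]
    simp [angularPart, hs]
  have hQ0 : 0 < ∫ θ in 0..2 * Real.pi, Q θ := by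
    have hQn : ∀ θ, 0 ≤ Q θ := fun θ ↦ by rw [hQ]; positivity
    refine intervalIntegral.integral_pos hpi hcQ.continuousOn (fun θ _ ↦ hQn θ) ?_
    by_contra! hcon
    have h0 : ∀ θ ∈ Set.Icc 0 (2 * Real.pi), radialPart a b r θ = 0 := fun θ hθ ↦ by
      have h1 := le_antisymm (hcon θ hθ) (hQn θ)
      rw [hQ] at h1
      have h2 := (div_eq_zero_iff.1 h1).resolve_right (pow_ne_zero 2 (hne θ))
      nlinarith [sq_nonneg (radialPart a b r θ), sq_nonneg (angularPart a b r θ)]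
    have e1 := h0 0 ⟨le_rfl, hpi.le⟩
    have e2 := h0 Real.pi ⟨Real.pi_pos.le, by linarith [Real.pi_pos]⟩
    simp only [radialPart, mul_zero, Real.cos_zero, Real.cos_pi, Real.cos_two_pi] at e1 e2
    have hb : b * r ^ 2 = 0 := by linarith
    have ha : a * r = 0 := by linarith
    have hb' := (mul_eq_zero.1 hb).resolve_right (by positivity)
    have ha' := (mul_eq_zero.1 ha).resolve_right hr.ne'
    exact hab (by rw [ha', hb'])
  have e : ∀ θ, ((a * Real.cos θ + 4 * b * (r * Real.cos (2 * θ))) * harmPolar a b r θ -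
      radialPart a b r θ * (2 * a * Real.cos θ + 4 * b * (r * Real.cos (2 * θ)))) /
        harmPolar a b r θ ^ 2 = r⁻¹ * (D θ - 2 * Q θ) := fun θ ↦ by
    rw [hD, hQ]
    have := hne θ
    have hN : (2 * a * Real.cos θ + 4 * b * (r * Real.cos (2 * θ))) =
        2 / r * radialPart a b r θ := by
      rw [radialPart]; field_simp; ring
    rw [hN]
    field_simp
    ring
  simp_rw [e]
  rw [intervalIntegral.integral_const_mul, intervalIntegral.integral_sub
    (hcD.intervalIntegrable _ _) ((hcQ.const_mul 2).intervalIntegrable _ _),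
    intervalIntegral.integral_const_mul, hD0]
  have : 0 < (2 * Real.pi)⁻¹ * (r⁻¹ * (2 * ∫ θ in 0..2 * Real.pi, Q θ)) := by positivity
  linarith

lemma excess_zero_right (a b : ℝ) : excess a b 0 = 0 := by
  simp [excess, harm]

lemma excess_zero_zero (r : ℝ) : excess 0 0 r = 0 := by
  simp [excess, harm, Real.circleAverage_const]

/-- In the interior of the region, `harm` is positive on the closed disk. -/
lemma harmPolar_pos_of_mem_interior {a b : ℝ} (hab : (a, b) ∈ interior region) {r : ℝ}
    (hr0 : 0 ≤ r) (hr : r ≤ 1) (θ : ℝ) : 0 < harmPolar a b r θ := by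
  -- A slight dilation `(ta, tb)`, `t > 1`, stays in the region, where `h ≥ 0` up to the unit
  -- circle. As `h` is affine in the parameters with value `1` at the origin, `t h - (t - 1) ≥ 0`
  -- forces `h > 0`.
  have htend : Tendsto (fun t : ℝ ↦ (t * a, t * b)) (𝓝[>] 1) (𝓝 (a, b)) := by
    have : Continuous fun t : ℝ ↦ (t * a, t * b) := by fun_prop
    simpa using (this.tendsto 1).mono_left nhdsWithin_le_nhds
  obtain ⟨t, ht, ht1⟩ := ((htend.eventually (mem_interior_iff_mem_nhds.1 hab)).and
    self_mem_nhdsWithin).exists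
  have ht1 : 1 < t := ht1
  have hnn : 0 ≤ harmPolar (t * a) (t * b) r θ := by
    have hc : Continuous fun s ↦ harmPolar (t * a) (t * b) s θ := by
      unfold harmPolar; fun_prop
    have hmem : r ∈ closure (Set.Ico (0 : ℝ) 1) := by
      rw [closure_Ico zero_ne_one]; exact ⟨hr0, hr⟩
    refine closure_minimal (t := {s | 0 ≤ harmPolar (t * a) (t * b) s θ}) (fun s hs ↦ ?_)
      (isClosed_le continuous_const hc) hmem
    rw [Set.mem_ofPred_eq, ← harm_circleMap]
    exact (harm_pos ht (by simpa [abs_of_nonneg hs.1] using hs.2)).le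
  have e : harmPolar (t * a) (t * b) r θ = t * harmPolar a b r θ - (t - 1) := by
    unfold harmPolar; ring
  rw [e] at hnn
  by_contra! hcon
  nlinarith

lemma excess_one_neg {a b : ℝ} (hab : (a, b) ∈ interior region) (h0 : (a, b) ≠ (0, 0)) :
    excess a b 1 < 0 := by
  have hanti : StrictAntiOn (excess a b) (Set.Icc 0 1) := by
    refine strictAntiOn_of_deriv_neg (convex_Icc 0 1) (fun r hr ↦ ?_) fun r hr ↦ ?_
    · exact (hasDerivAt_excess fun θ ↦
        harmPolar_pos_of_mem_interior hab hr.1 hr.2 θ).continuousAt.continuousWithinAt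
    · rw [interior_Icc] at hr
      exact deriv_excess_neg h0 hr.1 (harmPolar_pos_of_mem_interior hab hr.1.le hr.2.le)
  have := hanti (Set.left_mem_Icc.2 zero_le_one) (Set.right_mem_Icc.2 zero_le_one) one_pos
  rwa [excess_zero_right] at this

lemma isBigO_excess_sub_of_mem_interior {a b : ℝ} (hab : (a, b) ∈ interior region) :
    (fun r ↦ excess a b r - excess a b 1) =O[𝓝[<] 1] fun r ↦ 1 - r ^ 2 := by
  have h1 := (hasDerivAt_excess (harmPolar_pos_of_mem_interior hab zero_le_one le_rfl)).isBigO_sub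
  refine (h1.mono nhdsWithin_le_nhds).trans ?_
  refine IsBigO.of_bound 1 ?_
  filter_upwards [Ioo_mem_nhdsLT (zero_lt_one (α := ℝ))] with r hr
  rw [one_mul, Real.norm_eq_abs, Real.norm_eq_abs, abs_of_neg (by linarith [hr.2]),
    abs_of_pos (by nlinarith [hr.1, hr.2])]
  nlinarith [hr.1, hr.2]

end TwoDependentGAF

/-! ### Explicit circle averages -/

namespace TwoDependentGAF
open Metric

lemma circleIntegrable_comp_re {E : Type*} [NormedAddCommGroup E] {F : ℝ → E} {r : ℝ}
    (hr : 0 ≤ r) (hF : ∀ x ∈ Set.Icc (-r) r, ContinuousAt F x) :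
    CircleIntegrable (fun z ↦ F z.re) 0 r := by
  refine ContinuousOn.circleIntegrable hr fun z hz ↦ ?_
  have hre : |z.re| ≤ r := (Complex.abs_re_le_norm z).trans (mem_sphere_zero_iff_norm.1 hz).le
  exact ContinuousAt.continuousWithinAt
    (ContinuousAt.comp (hF _ (abs_le.1 hre)) Complex.continuous_re.continuousAt)

lemma norm_circleAverage_le {E : Type*} [NormedAddCommGroup E] [NormedSpace ℝ E] {F : ℂ → E}
    {r C : ℝ} (hr : 0 ≤ r) (hF : ∀ z, ‖z‖ = r → ‖F z‖ ≤ C) : ‖Real.circleAverage F 0 r‖ ≤ C := by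
  have hpi := Real.two_pi_pos
  have := intervalIntegral.norm_integral_le_of_norm_le_const (a := 0) (b := 2 * Real.pi)
    (f := fun θ ↦ F (circleMap 0 r θ)) (C := C) fun θ _ ↦ hF _ (by simp [abs_of_nonneg hr])
  rw [Real.circleAverage_def, norm_smul, norm_inv, Real.norm_of_nonneg hpi.le,
    inv_mul_le_iff₀ hpi]
  rw [sub_zero, abs_of_pos hpi] at this
  linarith

/-- Mean value property for a function holomorphic on the closed disk; inversion preserves averages
over the unit circle. -/
lemma circleAverage_inv_one_add_mul {q : ℂ} (hq : ‖q‖ < 1) :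
    Real.circleAverage (fun z ↦ 1 / (1 + q * z)) 0 1 = 1 ∧
    CircleIntegrable (fun z ↦ 1 / (1 + q * z)) 0 1 ∧
    Real.circleAverage (fun z ↦ 1 / (1 + q * z⁻¹)) 0 1 = 1 ∧
    CircleIntegrable (fun z ↦ 1 / (1 + q * z⁻¹)) 0 1 := by
  have hne : ∀ z : ℂ, ‖z‖ ≤ 1 → 1 + q * z ≠ 0 := fun z hz h0 ↦ by
    have h1 : q * z = -1 := by linear_combination h0
    have h2 : ‖q * z‖ = 1 := by rw [h1]; simp
    rw [norm_mul] at h2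
    nlinarith [norm_nonneg q, norm_nonneg z]
  have hlin : Differentiable ℂ fun z : ℂ ↦ 1 + q * z := by fun_prop
  have hd : DiffContOnCl ℂ (fun z ↦ 1 / (1 + q * z)) (ball 0 |1|) := by
    refine DifferentiableOn.diffContOnCl fun z hz ↦ ?_
    rw [abs_one, closure_ball _ one_ne_zero, mem_closedBall_zero_iff] at hz
    exact (DifferentiableAt.div (by fun_prop) (hlin z) (hne z hz)).differentiableWithinAt
  have h1 : Real.circleAverage (fun z ↦ 1 / (1 + q * z)) 0 1 = 1 := by
    rw [hd.circleAverage]; simp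
  refine ⟨h1, ?_, ?_, ?_⟩
  · refine ContinuousOn.circleIntegrable zero_le_one fun z hz ↦ ?_
    have := hne z (mem_sphere_zero_iff_norm.1 hz).le
    exact ContinuousAt.continuousWithinAt (ContinuousAt.div (by fun_prop) (by fun_prop) this)
  · exact (Real.circleAverage_zero_one_congr_inv (f := fun z ↦ 1 / (1 + q * z))).trans h1
  · refine ContinuousOn.circleIntegrable zero_le_one fun z hz ↦ ?_
    have hz1 := mem_sphere_zero_iff_norm.1 hz
    have := hne z⁻¹ (by rw [norm_inv, hz1, inv_one])
    have hz0 : z ≠ 0 := by rintro rfl; simp at hz1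
    exact ContinuousAt.continuousWithinAt
      (ContinuousAt.div (by fun_prop) (by fun_prop (disch := assumption)) this)

/-- The average of `1 / (u + Re z)` over the circle of radius `r` is `1 / √(u ^ 2 - r ^ 2)` for the
appropriate branch of the square root. -/
lemma circleAverage_inv_add_re {u s : ℂ} {r : ℝ} (hr : 0 < r) (hs : s ^ 2 = u ^ 2 - (r : ℂ) ^ 2)
    (hpos : 0 < (u * (starRingEnd ℂ) s).re) :
    (∀ z : ℂ, ‖z‖ = r → u + (z.re : ℂ) ≠ 0) ∧
    Real.circleAverage (fun z ↦ 1 / (u + (z.re : ℂ))) 0 r = 1 / s := by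
  have hr' : (r : ℂ) ≠ 0 := by exact_mod_cast hr.ne'
  have hprod : (u - s) * (u + s) = (r : ℂ) ^ 2 := by linear_combination -hs
  have hm : u - s ≠ 0 := fun h ↦ by
    rw [h, zero_mul] at hprod
    exact pow_ne_zero 2 hr' hprod.symm
  -- The branch condition says `|u - s| < |u + s|`, while the product of these moduli is `r²`.
  have hlt : ‖u - s‖ < r := by
    have h1 : ‖u - s‖ * ‖u + s‖ = r ^ 2 := by
      rw [← norm_mul, hprod, norm_pow, Complex.norm_real, Real.norm_of_nonneg hr.le]
    have h2 : ‖u - s‖ ^ 2 < ‖u + s‖ ^ 2 := by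
      rw [← Complex.normSq_eq_norm_sq, ← Complex.normSq_eq_norm_sq, Complex.normSq_sub,
        Complex.normSq_add]
      linarith
    have h3 : ‖u - s‖ < ‖u + s‖ := lt_of_pow_lt_pow_left₀ 2 (norm_nonneg _) h2
    have h4 : 0 < ‖u - s‖ := norm_pos_iff.2 hm
    by_contra! h
    nlinarith
  set q : ℂ := (u - s) / r with hq
  have hq0 : q ≠ 0 := div_ne_zero hm hr'
  have hq1 : ‖q‖ < 1 := by
    rw [hq, norm_div, Complex.norm_real, Real.norm_of_nonneg hr.le, div_lt_one hr]
    exact hlt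
  have hqs : u - s = q * r := by rw [hq]; field_simp
  have hps : (u + s) * q = r := by
    rw [hqs] at hprod
    have : r * ((u + s) * q) = (r : ℂ) * r := by linear_combination hprod
    exact mul_left_cancel₀ hr' this
  have hu : 2 * q * u = r * (1 + q ^ 2) := by linear_combination hps + q * hqs
  have hss : 2 * q * s = r * (1 - q ^ 2) := by linear_combination hps - q * hqs
  have hq2 : 1 - q ^ 2 ≠ 0 := fun h ↦ by
    have h1 : ‖q ^ 2‖ = 1 := by rw [← sub_eq_zero.1 h]; simp
    rw [norm_pow] at h1
    nlinarith [norm_nonneg q]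
  have hs0 : s ≠ 0 := by
    rintro rfl
    rw [mul_zero] at hss
    exact mul_ne_zero hr' hq2 hss.symm
  have hne : ∀ z : ℂ, ‖z‖ = 1 → 1 + q * z ≠ 0 := fun z hz h0 ↦ by
    have h1 : q * z = -1 := by linear_combination h0
    have h2 : ‖q * z‖ = 1 := by rw [h1]; simp
    rw [norm_mul, hz] at h2
    linarith
  -- On the unit circle `2 Re z = z + 1/z`, and `-q`, `-1/q` are the roots of the resulting
  -- quadratic in `z`. Partial fractions then leave averages equal to one.
  have hfac : ∀ z : ℂ, ‖z‖ = 1 → 2 * q * (u + r * (z.re : ℂ)) = r * ((1 + q * z) * (1 + q * z⁻¹)) := by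
    intro z hz
    have hz0 : z ≠ 0 := by rintro rfl; simp at hz
    have hinv : z⁻¹ = (starRingEnd ℂ) z := by
      rw [Complex.inv_def, Complex.normSq_eq_norm_sq, hz]; simp
    have hadd : z + z⁻¹ = 2 * z.re := by rw [hinv, Complex.add_conj]; push_cast; ring
    have hmul : z * z⁻¹ = 1 := mul_inv_cancel₀ hz0
    linear_combination hu - q * r * hadd - r * q ^ 2 * hmul
  have hne1 : ∀ z : ℂ, ‖z‖ = 1 → u + r * (z.re : ℂ) ≠ 0 := fun z hz h0 ↦ by
    have h1 := hfac z hz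
    rw [h0, mul_zero] at h1
    exact mul_ne_zero hr' (mul_ne_zero (hne z hz) (hne z⁻¹ (by rw [norm_inv, hz, inv_one]))) h1.symm
  constructor
  · intro z hz h0
    refine hne1 ((r : ℂ)⁻¹ * z) ?_ ?_
    · rw [norm_mul, norm_inv, Complex.norm_real, Real.norm_of_nonneg hr.le, hz, inv_mul_cancel₀ hr.ne']
    · rw [← Complex.ofReal_inv, Complex.re_ofReal_mul]
      push_cast
      rw [mul_inv_cancel_left₀ hr', h0]
  · obtain ⟨a1, i1, a2, i2⟩ := circleAverage_inv_one_add_mul hq1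
    rw [Real.circleAverage_eq_circleAverage_zero_one]
    have hcongr : Set.EqOn (fun z : ℂ ↦ 1 / (u + (((r : ℂ) * z + 0).re : ℂ)))
        (fun z ↦ (1 / s) • ((1 / (1 + q * z) + 1 / (1 + q * z⁻¹)) - 1)) (sphere 0 |1|) := by
      intro z hz
      rw [abs_one, mem_sphere_zero_iff_norm] at hz
      have hz0 : z ≠ 0 := by rintro rfl; simp at hz
      have n1 := hne z hz
      have n2 := hne z⁻¹ (by rw [norm_inv, hz, inv_one])
      have n3 := hne1 z hz
      have h1 := hfac z hz
      simp only [add_zero, Complex.re_ofReal_mul, Complex.ofReal_mul, smul_eq_mul]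
      have e1 : 1 / (1 + q * z) + 1 / (1 + q * z⁻¹) - 1 =
          (1 - q ^ 2) / ((1 + q * z) * (1 + q * z⁻¹)) := by
        rw [div_add_div _ _ n1 n2, div_sub_one (mul_ne_zero n1 n2)]
        congr 1
        have hmul : z * z⁻¹ = 1 := mul_inv_cancel₀ hz0
        linear_combination -q ^ 2 * hmul
      rw [e1, div_mul_div_comm, one_mul, div_eq_div_iff n3 (mul_ne_zero hs0 (mul_ne_zero n1 n2))]
      refine mul_left_cancel₀ (mul_ne_zero two_ne_zero (mul_ne_zero hq0 hr')) ?_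
      linear_combination (r * (1 + q * z) * (1 + q * z⁻¹)) * hss - (1 - q ^ 2) * r * h1
    rw [Real.circleAverage_congr_sphere hcongr, Real.circleAverage_fun_smul,
      Real.circleAverage_fun_sub (f₁ := fun z ↦ 1 / (1 + q * z) + 1 / (1 + q * z⁻¹)) (i1.add i2)
        (circleIntegrable_const _ _ _),
      Real.circleAverage_fun_add i1 i2, a1, a2, Real.circleAverage_const]
    simp

lemma circleAverage_inv_add_re_real {u s r : ℝ} (hr : 0 < r) (hu : 0 < u) (hs0 : 0 < s)
    (hs : s ^ 2 = u ^ 2 - r ^ 2) :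
    Real.circleAverage (fun z ↦ 1 / (u + z.re)) 0 r = 1 / s := by
  obtain ⟨-, h⟩ := circleAverage_inv_add_re (u := u) (s := s) hr (by exact_mod_cast hs)
    (by rw [Complex.conj_ofReal, ← Complex.ofReal_mul, Complex.ofReal_re]; positivity)
  have hlt : r < u := lt_of_pow_lt_pow_left₀ 2 hu.le (by nlinarith)
  have hi : CircleIntegrable (fun z ↦ (1 : ℂ) / ((u : ℂ) + (z.re : ℂ))) 0 r := by
    refine circleIntegrable_comp_re (F := fun x : ℝ ↦ (1 : ℂ) / ((u : ℂ) + (x : ℂ))) hr.le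
      fun x hx ↦ ContinuousAt.div (by fun_prop) (by fun_prop) ?_
    have : u + x ≠ 0 := by linarith [hx.1]
    exact_mod_cast this
  have := Complex.reCLM.circleAverage_comp_comm hi
  rw [h] at this
  have e : (Complex.reCLM ∘ fun z : ℂ ↦ (1 : ℂ) / ((u : ℂ) + (z.re : ℂ))) = fun z : ℂ ↦ 1 / (u + z.re) := by
    ext z
    rw [Function.comp_apply, ← Complex.ofReal_add, ← Complex.ofReal_one, ← Complex.ofReal_div]
    rfl
  rw [e] at this
  rw [this, ← Complex.ofReal_one, ← Complex.ofReal_div]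
  rfl

/-- `Re z² = 2 (Re z)² - r²` removes the imaginary part. -/
lemma harm_of_norm_eq (a b : ℝ) {z : ℂ} {r : ℝ} (hz : ‖z‖ = r) :
    harm a b z = 4 * b * z.re ^ 2 + 2 * a * z.re + (1 - 2 * b * r ^ 2) := by
  rw [harm, sq z, Complex.mul_re, ← hz, ← Complex.normSq_eq_norm_sq, Complex.normSq_apply]; ring

/-- The substitution `z ↦ -z` preserves the circle and changes the sign of `a`. -/
lemma excess_neg_left (a b r : ℝ) : excess (-a) b r = excess a b r := by
  have h := Real.circleAverage_neg_radius (f := fun z ↦ 1 - (1 + a * z.re) / harm a b z) (c := 0)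
    (R := r)
  rw [excess, excess, ← h, Real.circleAverage_def, Real.circleAverage_def]
  congr 2
  ext θ
  have e : circleMap 0 (-r) θ = -circleMap 0 r θ := by simp [circleMap]
  rw [e]
  simp [harm]

/-- The excess when `harm` has a double root in the variable `Re z` at `r = 1`. -/
lemma excess_eq_of_double_root {a b m r ε : ℝ} {s : ℂ} (hb : 0 < b) (ha : a = 4 * b * m)
    (hm : 4 * b * m ^ 2 = 1 - 2 * b) (hr : 0 < r) (hε : 0 < ε) (hεr : 2 * ε ^ 2 = 1 - r ^ 2)
    (hs : s ^ 2 = (m + ε * Complex.I) ^ 2 - (r : ℂ) ^ 2)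
    (hpos : 0 < ((m + ε * Complex.I) * (starRingEnd ℂ) s).re) :
    excess a b r = 1 + 1 / (2 * ε) * (1 / s).im - m * (1 / s).re := by
  obtain ⟨hne, h⟩ := circleAverage_inv_add_re hr hs hpos
  set u : ℂ := m + ε * Complex.I with hu
  have hure : u.re = m := by simp [hu]
  have huim : u.im = ε := by simp [hu]
  have hi : CircleIntegrable (fun z ↦ (1 : ℂ) / (u + (z.re : ℂ))) 0 r := by
    refine ContinuousOn.circleIntegrable hr.le fun z hz ↦ ?_
    exact ContinuousAt.continuousWithinAt (ContinuousAt.div (by fun_prop) (by fun_prop)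
      (hne z (mem_sphere_zero_iff_norm.1 hz)))
  have h1 := Complex.reCLM.circleAverage_comp_comm hi
  have h2 := Complex.imCLM.circleAverage_comp_comm hi
  rw [h] at h1 h2
  have i1 : CircleIntegrable (Complex.reCLM ∘ fun z ↦ (1 : ℂ) / (u + (z.re : ℂ))) 0 r :=
    ⟨hi.1.re, hi.2.re⟩
  have i2 : CircleIntegrable (Complex.imCLM ∘ fun z ↦ (1 : ℂ) / (u + (z.re : ℂ))) 0 r :=
    ⟨hi.1.im, hi.2.im⟩
  -- Here `h = 4b ((m + x)² + ε²)` with `x = Re z`, so both partial fractions are read off from the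
  -- real and imaginary parts of `1 / (u + x)`, `u = m + iε`.
  have hcongr : Set.EqOn (fun z : ℂ ↦ 1 - (1 + a * z.re) / harm a b z)
      (fun z ↦ 1 + (1 / (2 * ε)) • (Complex.imCLM ∘ fun z ↦ (1 : ℂ) / (u + (z.re : ℂ))) z
        - m • (Complex.reCLM ∘ fun z ↦ (1 : ℂ) / (u + (z.re : ℂ))) z) (sphere 0 |r|) := by
    intro z hz
    rw [abs_of_pos hr, mem_sphere_zero_iff_norm] at hz
    simp only [Function.comp_apply, Complex.imCLM_apply, Complex.reCLM_apply, smul_eq_mul,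
      one_div, Complex.inv_re, Complex.inv_im, Complex.normSq_apply, Complex.add_re, Complex.add_im,
      Complex.ofReal_re, Complex.ofReal_im, add_zero, hure, huim]
    have hq : 0 < (m + z.re) * (m + z.re) + ε * ε := by nlinarith [mul_self_nonneg (m + z.re)]
    have hh : harm a b z = 4 * b * ((m + z.re) * (m + z.re) + ε * ε) := by
      rw [harm_of_norm_eq a b hz, ha]
      linear_combination -hm - 2 * b * hεr
    have hnum : 1 + a * z.re = 2 * b + 4 * b * m * (m + z.re) := by
      rw [ha]; linear_combination -hm
    rw [hh, hnum]
    field_simp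
    ring
  rw [excess, Real.circleAverage_congr_sphere hcongr, Real.circleAverage_fun_sub,
    Real.circleAverage_fun_add, Real.circleAverage_fun_smul, Real.circleAverage_fun_smul, h1, h2,
    Real.circleAverage_const]
  · rfl
  · exact circleIntegrable_const _ _ _
  · exact i2.const_smul
  · exact (circleIntegrable_const _ _ _).add i2.const_smul
  · exact i1.const_smul

end TwoDependentGAF

/-! ### Asymptotics on the arc and at the cusps -/

namespace TwoDependentGAF
open Metric

lemma exists_eventually_norm_sub_le {F : ℂ → ℂ} (hF : DifferentiableAt ℂ F 0) :
    ∃ C : ℝ, 0 ≤ C ∧ ∀ᶠ e : ℝ in 𝓝 0, ‖F e - F 0‖ ≤ C * |e| := by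
  obtain ⟨C, hC⟩ := hF.isBigO_sub.bound
  refine ⟨max C 0, le_max_right _ _, ?_⟩
  have hc : Tendsto (fun e : ℝ ↦ (e : ℂ)) (𝓝 0) (𝓝 0) := by
    simpa using Complex.continuous_ofReal.tendsto 0
  filter_upwards [hc.eventually hC] with e he
  rw [sub_zero, Complex.norm_real, Real.norm_eq_abs] at he
  exact he.trans (by gcongr; exact le_max_left _ _)

lemma tendsto_sqrt_half_one_sub_sq :
    Tendsto (fun r : ℝ ↦ √((1 - r ^ 2) / 2)) (𝓝[<] 1) (𝓝 0) := by
  have : Continuous fun r : ℝ ↦ √((1 - r ^ 2) / 2) := by fun_prop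
  simpa using (this.tendsto 1).mono_left nhdsWithin_le_nhds

lemma cpow_half_sq (w : ℂ) : (w ^ (1 / 2 : ℂ)) ^ 2 = w := by
  have := Complex.cpow_nat_inv_pow w two_ne_zero
  rwa [show ((2 : ℕ) : ℂ)⁻¹ = 1 / 2 by norm_num] at this

/-- Asymptotics on the elliptic arc. -/
lemma isBigO_excess_arc {a b : ℝ} (hab : a ^ 2 = 4 * b - 8 * b ^ 2) (hb : 1 / 6 < b) :
    (fun r : ℝ ↦ excess a b r + √(2 * b / (6 * b - 1)) * (1 / √(1 - r ^ 2)))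
      =O[𝓝[<] 1] (fun _ ↦ (1 : ℝ)) := by
  have hb0 : 0 < b := by linarith
  set m : ℝ := a / (4 * b) with hm
  have ha : a = 4 * b * m := by rw [hm]; field_simp
  have hm2 : 4 * b * m ^ 2 = 1 - 2 * b := by
    rw [hm]
    field_simp
    linarith
  have hm1 : 0 < 1 - m ^ 2 := by
    have : 0 < 4 * b * (1 - m ^ 2) := by linarith
    exact pos_of_mul_pos_right this (by linarith)
  -- With `r² = 1 - 2ε²`, `u² - r² = -τ(ε)²`, so `s = iτ(ε)`. Since `4b (1 - m²) = 6b - 1 > 0`, `τ`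
  -- is holomorphic and nonzero at `0`; the leading term is `-1 / (2ε τ(0))`.
  set τ : ℂ → ℂ := fun e ↦ (1 - (m : ℂ) ^ 2 - e ^ 2 - 2 * m * e * Complex.I) ^ (1 / 2 : ℂ) with hτ
  have hτ0 : τ 0 = (√(1 - m ^ 2) : ℝ) := by
    rw [hτ, Real.sqrt_eq_rpow, Complex.ofReal_cpow hm1.le]
    push_cast
    simp
  have hslit : (1 - (m : ℂ) ^ 2 - 0 ^ 2 - 2 * m * 0 * Complex.I) ∈ Complex.slitPlane := by
    have e : (1 - (m : ℂ) ^ 2 - 0 ^ 2 - 2 * m * 0 * Complex.I) = ((1 - m ^ 2 : ℝ) : ℂ) := by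
      push_cast; ring
    rw [e]
    exact Complex.ofReal_mem_slitPlane.2 hm1
  have hτd : DifferentiableAt ℂ τ 0 := DifferentiableAt.cpow_const (by fun_prop) hslit
  have hτne : τ 0 ≠ 0 := by
    rw [hτ0]
    exact_mod_cast (Real.sqrt_pos.2 hm1).ne'
  obtain ⟨C, hC0, hC⟩ := exists_eventually_norm_sub_le (hτd.inv hτne)
  have hpos : ∀ᶠ e : ℝ in 𝓝 0, 0 < (τ e).re := by
    have hc : Tendsto (fun e : ℝ ↦ (τ e).re) (𝓝 0) (𝓝 (τ 0).re) := by
      have h1 : Tendsto (fun e : ℝ ↦ (e : ℂ)) (𝓝 0) (𝓝 0) := by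
        simpa using Complex.continuous_ofReal.tendsto 0
      exact (Complex.continuous_re.tendsto _).comp (hτd.continuousAt.tendsto.comp h1)
    refine hc.eventually_const_lt ?_
    rw [hτ0, Complex.ofReal_re]
    exact Real.sqrt_pos.2 hm1
  refine IsBigO.of_bound (1 + C + |m| * (C + ‖(τ 0)⁻¹‖)) ?_
  have hsmall : ∀ᶠ e : ℝ in 𝓝 0, |e| ≤ 1 := by
    have : Tendsto (fun e : ℝ ↦ |e|) (𝓝 0) (𝓝 0) := by simpa using continuous_abs.tendsto (0 : ℝ)
    filter_upwards [this.eventually_lt_const one_pos] with e he using he.le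
  filter_upwards [tendsto_sqrt_half_one_sub_sq.eventually (hC.and (hpos.and hsmall)),
    Ioo_mem_nhdsLT (zero_lt_one (α := ℝ))] with r hr hr01
  have hδ : 0 < 1 - r ^ 2 := by nlinarith [hr01.1, hr01.2]
  set ε := √((1 - r ^ 2) / 2) with hε
  have hε0 : 0 < ε := Real.sqrt_pos.2 (by positivity)
  have hεr : 2 * ε ^ 2 = 1 - r ^ 2 := by rw [hε, Real.sq_sqrt (by positivity)]; ring
  obtain ⟨hr1, hr2, hr3⟩ := hr
  have hr2c : (r : ℂ) ^ 2 = 1 - 2 * (ε : ℂ) ^ 2 := by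
    have : r ^ 2 = 1 - 2 * ε ^ 2 := by linarith
    exact_mod_cast this
  have hsq : τ ε ^ 2 = 1 - (m : ℂ) ^ 2 - (ε : ℂ) ^ 2 - 2 * m * ε * Complex.I := cpow_half_sq _
  have him : (τ ε).re * (τ ε).im = -(m * ε) := by
    have := congrArg Complex.im hsq
    simp [sq] at this
    linarith
  have hex := excess_eq_of_double_root (s := Complex.I * τ ε) hb0 ha hm2 hr01.1 hε0 hεr
    (by rw [mul_pow, hsq, hr2c, Complex.I_sq]
        linear_combination -(ε : ℂ) ^ 2 * Complex.I_sq)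
    (by
      have h1 : (((m : ℂ) + ε * Complex.I) * (starRingEnd ℂ) (Complex.I * τ ε)).re =
          ε * (τ ε).re - m * (τ ε).im := by
        simp
      rw [h1]
      -- Multiplying by `Re τ > 0` and using `Re τ · Im τ = -mε` exposes the sign, so `iτ` is the
      -- right branch.
      have h2 : 0 < (τ ε).re * (ε * (τ ε).re - m * (τ ε).im) := by
        have : (τ ε).re * (ε * (τ ε).re - m * (τ ε).im) = ε * ((τ ε).re ^ 2 + m ^ 2) := by
          linear_combination -m * him
        rw [this]
        have := pow_pos hr2 2
        positivity
      exact pos_of_mul_pos_right h2 hr2.le)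
  have hinv : 1 / (Complex.I * τ ε) = -(Complex.I * (τ ε)⁻¹) := by
    rw [one_div, mul_inv, Complex.inv_I, neg_mul]
  rw [hinv] at hex
  simp only [Complex.neg_im, Complex.neg_re, Complex.I_mul_im, Complex.I_mul_re, neg_neg] at hex
  have hconst : √(2 * b / (6 * b - 1)) * (1 / √(1 - r ^ 2)) = 1 / (2 * ε) * ((τ 0)⁻¹).re := by
    rw [hτ0, ← Complex.ofReal_inv, Complex.ofReal_re]
    have h1 : 2 * b / (6 * b - 1) = (2 * (1 - m ^ 2))⁻¹ := by
      have h2 : 2 * (1 - m ^ 2) = (6 * b - 1) / (2 * b) := by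
        field_simp
        linarith
      rw [h2, inv_div]
    have h3 : √(1 - r ^ 2) = √2 * ε := by
      rw [← hεr, Real.sqrt_mul (by norm_num), Real.sqrt_sq hε0.le]
    have h4 : √2 * √2 = (2 : ℝ) := Real.mul_self_sqrt (by norm_num)
    have h5 := Real.sqrt_pos.2 hm1
    have h6 : (0 : ℝ) < √2 := by positivity
    rw [h1, Real.sqrt_inv, Real.sqrt_mul (by norm_num), h3, mul_inv, one_div, one_div, mul_inv,
      mul_inv]
    have h7 : (√2)⁻¹ * (√2)⁻¹ = (2 : ℝ)⁻¹ := by rw [← mul_inv, h4]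
    linear_combination (√(1 - m ^ 2))⁻¹ * ε⁻¹ * h7
  rw [hex, hconst]
  have hE : ‖(τ ε)⁻¹ - (τ 0)⁻¹‖ ≤ C * ε := by simpa [abs_of_pos hε0] using hr1
  have hE1 : |((τ ε)⁻¹).re - ((τ 0)⁻¹).re| ≤ C * ε := by
    rw [← Complex.sub_re]; exact (Complex.abs_re_le_norm _).trans hE
  have hE2 : |((τ ε)⁻¹).im| ≤ C + ‖(τ 0)⁻¹‖ := by
    refine (Complex.abs_im_le_norm _).trans ?_
    have h1 : ‖(τ ε)⁻¹‖ ≤ ‖(τ ε)⁻¹ - (τ 0)⁻¹‖ + ‖(τ 0)⁻¹‖ := by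
      simpa using norm_add_le ((τ ε)⁻¹ - (τ 0)⁻¹) (τ 0)⁻¹
    rw [abs_of_pos hε0] at hr3
    nlinarith
  have e : 1 + 1 / (2 * ε) * -((τ ε)⁻¹).re - m * ((τ ε)⁻¹).im + 1 / (2 * ε) * ((τ 0)⁻¹).re =
      1 + -(1 / (2 * ε) * (((τ ε)⁻¹).re - ((τ 0)⁻¹).re)) + -(m * ((τ ε)⁻¹).im) := by ring
  rw [e, norm_one, mul_one]
  refine (norm_add₃_le).trans ?_
  rw [norm_one, norm_neg, norm_neg, norm_mul, norm_mul, Real.norm_eq_abs, Real.norm_eq_abs,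
    Real.norm_eq_abs, Real.norm_eq_abs, abs_of_pos (by positivity : 0 < 1 / (2 * ε))]
  have h1 : 1 / (2 * ε) * |((τ ε)⁻¹).re - ((τ 0)⁻¹).re| ≤ C := by
    calc _ ≤ 1 / (2 * ε) * (C * ε) := by gcongr
      _ = C / 2 := by field_simp
      _ ≤ C := by linarith
  gcongr

/-- Asymptotics at the point where the arc meets the segment. -/
lemma isBigO_excess_cusp :
    (fun r : ℝ ↦ excess (2 / 3) (1 / 6) r +
        1 / (2 : ℝ) ^ (5 / 4 : ℝ) * (1 / (1 - r ^ 2) ^ (3 / 4 : ℝ)))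
      =O[𝓝[<] 1] (fun r ↦ 1 / (1 - r ^ 2) ^ (1 / 4 : ℝ)) := by
  -- Now `m = 1` and `u² - r² = 2iε (1 - iε/2)`, so `s = √ε (1 + i) w(ε)` because `(1 + i)² = 2i`.
  -- The extra `√ε` raises the exponent from `1/2` to `3/4`.
  set w : ℂ → ℂ := fun e ↦ (1 - e * Complex.I / 2) ^ (1 / 2 : ℂ) with hw
  have hw0 : w 0 = 1 := by simp [hw]
  have hwd : DifferentiableAt ℂ w 0 := DifferentiableAt.cpow_const (by fun_prop) (by simp)
  obtain ⟨C, hC0, hC⟩ := exists_eventually_norm_sub_le (hwd.inv (by rw [hw0]; exact one_ne_zero))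
  have hpos : ∀ᶠ e : ℝ in 𝓝 0,
      0 < ((1 + e * Complex.I) * (starRingEnd ℂ) ((1 + Complex.I) * w e)).re := by
    have h1 : Tendsto (fun e : ℝ ↦ (e : ℂ)) (𝓝 0) (𝓝 0) := by
      simpa using Complex.continuous_ofReal.tendsto 0
    have h2 : Tendsto (fun e : ℝ ↦ w e) (𝓝 0) (𝓝 1) := by
      rw [← hw0]; exact hwd.continuousAt.tendsto.comp h1
    have h3 := ((h1.mul_const Complex.I).const_add 1).mul
      ((Complex.continuous_conj.tendsto _).comp (h2.const_mul (1 + Complex.I)))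
    have h4 := (Complex.continuous_re.tendsto _).comp h3
    refine h4.eventually_const_lt ?_
    simp
  refine IsBigO.of_bound (2 ^ (1 / 4 : ℝ) * (2 + 2 * C)) ?_
  have hsmall : ∀ᶠ e : ℝ in 𝓝 0, |e| ≤ 1 := by
    have : Tendsto (fun e : ℝ ↦ |e|) (𝓝 0) (𝓝 0) := by simpa using continuous_abs.tendsto (0 : ℝ)
    filter_upwards [this.eventually_lt_const one_pos] with e he using he.le
  filter_upwards [tendsto_sqrt_half_one_sub_sq.eventually (hC.and (hpos.and hsmall)),
    Ioo_mem_nhdsLT (zero_lt_one (α := ℝ))] with r hr hr01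
  have hδ : 0 < 1 - r ^ 2 := by nlinarith [hr01.1, hr01.2]
  set ε := √((1 - r ^ 2) / 2) with hε
  have hε0 : 0 < ε := Real.sqrt_pos.2 (by positivity)
  have hεr : 2 * ε ^ 2 = 1 - r ^ 2 := by rw [hε, Real.sq_sqrt (by positivity)]; ring
  obtain ⟨hr1, hr2, hr3⟩ := hr
  rw [abs_of_pos hε0] at hr1 hr3
  have hr2c : (r : ℂ) ^ 2 = 1 - 2 * (ε : ℂ) ^ 2 := by
    have : r ^ 2 = 1 - 2 * ε ^ 2 := by linarith
    exact_mod_cast this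
  have hsq : w ε ^ 2 = 1 - ε * Complex.I / 2 := cpow_half_sq _
  set η := √ε with hη
  have hη0 : 0 < η := Real.sqrt_pos.2 hε0
  have hη2 : η ^ 2 = ε := Real.sq_sqrt hε0.le
  have hη2c : (η : ℂ) ^ 2 = ε := by exact_mod_cast hη2
  have hη1 : η ≤ 1 := by rw [hη]; exact Real.sqrt_le_one.2 hr3
  have hex := excess_eq_of_double_root (a := 2 / 3) (b := 1 / 6) (m := 1)
    (s := η * ((1 + Complex.I) * w ε)) (by norm_num) (by norm_num) (by norm_num) hr01.1 hε0 hεr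
    (by rw [mul_pow, mul_pow, hsq, hr2c, hη2c]
        push_cast
        linear_combination (-2 * (ε : ℂ) ^ 2 + ε - ε ^ 2 * Complex.I / 2) * Complex.I_sq)
    (by
      rw [map_mul, Complex.conj_ofReal, mul_left_comm, Complex.re_ofReal_mul]
      push_cast
      exact mul_pos hη0 hr2)
  have hinv : 1 / ((η : ℂ) * ((1 + Complex.I) * w ε)) =
      ((1 / (2 * η) : ℝ) : ℂ) * ((1 - Complex.I) * (w ε)⁻¹) := by
    have h1 : (1 + Complex.I)⁻¹ = (1 - Complex.I) / 2 := by
      rw [inv_eq_iff_eq_inv, eq_comm, inv_eq_iff_eq_inv, eq_comm]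
      refine inv_eq_of_mul_eq_one_right ?_
      linear_combination (-1 / 2 : ℂ) * Complex.I_sq
    rw [one_div, mul_inv, mul_inv, h1]
    push_cast
    ring
  rw [hinv, Complex.im_ofReal_mul, Complex.re_ofReal_mul] at hex
  set F := (w ε)⁻¹ with hF
  have hFre : ((1 - Complex.I) * F).re = F.re + F.im := by simp
  have hFim : ((1 - Complex.I) * F).im = F.im - F.re := by simp; ring
  rw [hFre, hFim] at hex
  have hE : ‖F - 1‖ ≤ C * ε := by simpa [hw0] using hr1
  have hE1 : |F.re - 1| ≤ C * ε := by
    have := (Complex.abs_re_le_norm (F - 1)).trans hE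
    simpa using this
  have hE2 : |F.im| ≤ C * ε := by
    have := (Complex.abs_im_le_norm (F - 1)).trans hE
    simpa using this
  have hp4 : (1 - r ^ 2) ^ (1 / 4 : ℝ) = 2 ^ (1 / 4 : ℝ) * η := by
    rw [← hεr, Real.mul_rpow (by norm_num) (by positivity), ← hη2, ← pow_mul,
      ← Real.rpow_natCast, ← Real.rpow_mul hη0.le]
    norm_num
  have hp34 : (1 - r ^ 2) ^ (3 / 4 : ℝ) = 2 ^ (3 / 4 : ℝ) * η ^ 3 := by
    rw [← hεr, Real.mul_rpow (by norm_num) (by positivity), ← hη2, ← pow_mul,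
      ← Real.rpow_natCast, ← Real.rpow_mul hη0.le, ← Real.rpow_natCast η 3]
    norm_num
  have h2p : (2 : ℝ) ^ (5 / 4 : ℝ) * 2 ^ (3 / 4 : ℝ) = 4 := by
    rw [← Real.rpow_add (by norm_num)]
    norm_num
  have h2q : (0 : ℝ) < 2 ^ (1 / 4 : ℝ) := by positivity
  have hmain : 1 / (2 : ℝ) ^ (5 / 4 : ℝ) * (1 / (1 - r ^ 2) ^ (3 / 4 : ℝ)) = 1 / (4 * η ^ 3) := by
    rw [hp34, div_mul_div_comm, ← mul_assoc, h2p, one_mul]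
  rw [hmain, hp4, hex]
  -- With `η = √ε`, the term `1 / (4η³)` cancels the leading part; `F = 1 + O(ε)` leaves a bounded
  -- numerator over `4η`.
  have e : 1 + 1 / (2 * ε) * (1 / (2 * η) * (F.im - F.re)) - 1 * (1 / (2 * η) * (F.re + F.im)) +
      1 / (4 * η ^ 3) =
      (4 * η + (F.im - (F.re - 1)) / ε - 2 * ((F.re - 1) + F.im) - 2) / (4 * η) := by
    rw [← hη2]
    field_simp
    ring
  rw [e, norm_div, Real.norm_of_nonneg (by positivity : 0 ≤ 4 * η), div_le_iff₀ (by positivity)]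
  have e2 : 2 ^ (1 / 4 : ℝ) * (2 + 2 * C) * ‖1 / (2 ^ (1 / 4 : ℝ) * η)‖ * (4 * η) =
      8 + 8 * C := by
    rw [Real.norm_of_nonneg (by positivity)]
    field_simp
    ring
  rw [e2]
  have h3 : |(F.im - (F.re - 1)) / ε| ≤ 2 * C := by
    rw [abs_div, abs_of_pos hε0, div_le_iff₀ hε0]
    exact (abs_sub _ _).trans (by linarith)
  have h4 : C * ε ≤ C := mul_le_of_le_one_right hC0 hr3
  rw [Real.norm_eq_abs, abs_le]
  obtain ⟨h5, h6⟩ := abs_le.1 h3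
  obtain ⟨h7, h8⟩ := abs_le.1 hE1
  obtain ⟨h9, h10⟩ := abs_le.1 hE2
  constructor <;> linarith

end TwoDependentGAF

/-! ### Asymptotics on the segments and at the corner -/

namespace TwoDependentGAF
open Metric

lemma circleAverage_const_add_mul_add_mul {f g : ℂ → ℝ} {r : ℝ} (hf : CircleIntegrable f 0 r)
    (hg : CircleIntegrable g 0 r) (c p q : ℝ) :
    Real.circleAverage (fun z ↦ c + p * f z + q * g z) 0 r =
      c + p * Real.circleAverage f 0 r + q * Real.circleAverage g 0 r := by
  have h1 : CircleIntegrable (fun z ↦ p * f z) 0 r := hf.const_smul (a := p)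
  have h2 : CircleIntegrable (fun z ↦ q * g z) 0 r := hg.const_smul (a := q)
  have h0 : CircleIntegrable (fun _ ↦ c) 0 r := circleIntegrable_const _ _ _
  have e1 : Real.circleAverage (fun z ↦ p * f z) 0 r = p * Real.circleAverage f 0 r :=
    Real.circleAverage_smul (a := p) (f := f)
  have e2 : Real.circleAverage (fun z ↦ q * g z) 0 r = q * Real.circleAverage g 0 r :=
    Real.circleAverage_smul (a := q) (f := g)
  have h01 : CircleIntegrable (fun z ↦ c + p * f z) 0 r := h0.add h1
  rw [Real.circleAverage_fun_add h01 h2, Real.circleAverage_fun_add h0 h1, e1, e2,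
    Real.circleAverage_const]

/-- The excess when `harm` has a simple root near the circle of radius `r`. -/
lemma excess_eq_of_simple_root {b r d v u α c₀ : ℝ} (hr0 : 0 < r) (hr1 : r < 1) (hc₀pos : 0 < c₀)
    (hvd : v = b + 1 / 2 + d) (hbu : 4 * b * u = b + 1 / 2 - d) (huv : u * v = 1 - 2 * b * r ^ 2)
    (hupos : 0 < u) (hα : α * (2 * d) = 1 - (b + 1 / 2) * u)
    (hx4 : ∀ x ∈ Set.Icc (-r) r, c₀ ≤ 4 * b * x + v)
    (hw : 0 < v ^ 2 - 16 * b ^ 2 * r ^ 2) (hz : 0 < 1 - 4 * b ^ 2 * r ^ 2) :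
    ∃ A, |A| ≤ 1 / c₀ ∧ excess (b + 1 / 2) b r =
      1 - α * (√(v ^ 2 - 16 * b ^ 2 * r ^ 2) / √(1 - 4 * b ^ 2 * r ^ 2)) / √(1 - r ^ 2) -
        (b + 1 / 2 - 4 * b * α) * A := by
  have hδ : 0 < 1 - r ^ 2 := by nlinarith
  set s := √(1 - r ^ 2) * √(1 - 4 * b ^ 2 * r ^ 2) / √(v ^ 2 - 16 * b ^ 2 * r ^ 2) with hs
  have hspos : 0 < s := by rw [hs]; positivity
  -- Evaluate `h(r) h(-r)` twice: the factorization gives `(u² - r²)(v² - 16b²r²)`, and `a = b +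
  -- 1/2` gives `(1 - r²)(1 - 4b²r²)`.
  have hssq : s ^ 2 = u ^ 2 - r ^ 2 := by
    rw [hs, div_pow, mul_pow, Real.sq_sqrt hδ.le, Real.sq_sqrt hz.le, Real.sq_sqrt hw.le,
      div_eq_iff hw.ne']
    have h1 : v + 4 * b * u = 2 * b + 1 := by rw [hbu, hvd]; ring
    have h2 : v ^ 2 + 16 * b ^ 2 * u ^ 2 = (2 * b + 1) ^ 2 - 8 * b * (1 - 2 * b * r ^ 2) := by
      linear_combination (v + 4 * b * u + 2 * b + 1) * h1 - 8 * b * huv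
    linear_combination r ^ 2 * h2 - (u * v + 1 - 2 * b * r ^ 2) * huv
  have hru : r < u := lt_of_pow_lt_pow_left₀ 2 hupos.le (by nlinarith [pow_pos hspos 2])
  have havg := circleAverage_inv_add_re_real hr0 hupos hspos hssq
  have i1 : CircleIntegrable (fun z ↦ 1 / (u + z.re)) 0 r :=
    circleIntegrable_comp_re (F := fun x ↦ 1 / (u + x)) hr0.le fun x hx ↦
      ContinuousAt.div (by fun_prop) (by fun_prop) (by linarith [hx.1])
  have i2 : CircleIntegrable (fun z ↦ 1 / (4 * b * z.re + v)) 0 r :=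
    circleIntegrable_comp_re (F := fun x ↦ 1 / (4 * b * x + v)) hr0.le fun x hx ↦
      ContinuousAt.div (by fun_prop) (by fun_prop) (by linarith [hx4 x hx])
  have hcongr : Set.EqOn (fun z : ℂ ↦ 1 - (1 + (b + 1 / 2) * z.re) / harm (b + 1 / 2) b z)
      (fun z ↦ 1 + -α * (1 / (u + z.re)) + -(b + 1 / 2 - 4 * b * α) * (1 / (4 * b * z.re + v)))
      (sphere 0 |r|) := by
    intro z hz
    rw [abs_of_pos hr0, mem_sphere_zero_iff_norm] at hz
    have hx : z.re ∈ Set.Icc (-r) r := abs_le.1 ((Complex.abs_re_le_norm z).trans hz.le)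
    have n1 : u + z.re ≠ 0 := by linarith [hx.1]
    have n2 : 4 * b * z.re + v ≠ 0 := by linarith [hx4 _ hx]
    have hh : harm (b + 1 / 2) b z = (u + z.re) * (4 * b * z.re + v) := by
      rw [harm_of_norm_eq _ _ hz]
      linear_combination -huv - z.re * (hbu + hvd)
    -- Partial fractions; evaluating at `x = -u` determines `α`.
    have hnum : 1 + (b + 1 / 2) * z.re =
        α * (4 * b * z.re + v) + (b + 1 / 2 - 4 * b * α) * (u + z.re) := by
      linear_combination -hα + α * (hbu - hvd)
    simp only [hh, hnum]
    generalize 4 * b * z.re + v = Y at n2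
    generalize u + z.re = X at n1
    field_simp
    ring
  have hA2 : |Real.circleAverage (fun z ↦ 1 / (4 * b * z.re + v)) 0 r| ≤ 1 / c₀ := by
    rw [← Real.norm_eq_abs]
    refine norm_circleAverage_le hr0.le fun z hz ↦ ?_
    have h1 := hx4 z.re (abs_le.1 ((Complex.abs_re_le_norm z).trans hz.le))
    rw [Real.norm_of_nonneg (by have := hc₀pos.trans_le h1; positivity)]
    gcongr
  have hex : excess (b + 1 / 2) b r = 1 - α * (1 / s) - (b + 1 / 2 - 4 * b * α) *
      Real.circleAverage (fun z ↦ 1 / (4 * b * z.re + v)) 0 r := by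
    rw [excess, Real.circleAverage_congr_sphere hcongr,
      circleAverage_const_add_mul_add_mul i1 i2, havg]
    ring
  refine ⟨_, hA2, ?_⟩
  rw [hex]
  have hαs : α * (1 / s) =
      α * (√(v ^ 2 - 16 * b ^ 2 * r ^ 2) / √(1 - 4 * b ^ 2 * r ^ 2)) / √(1 - r ^ 2) := by
    have h1 := Real.sqrt_pos.2 hδ
    have h2 := Real.sqrt_pos.2 hz
    have h3 := Real.sqrt_pos.2 hw
    simp only [hs]
    field_simp
  rw [hαs]

/-- Asymptotics on the open segment `b = a - 1 / 2`. -/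
lemma isBigO_excess_segment {b : ℝ} (hb1 : -1 / 2 < b) (hb2 : b < 1 / 6) :
    (fun r : ℝ ↦ excess (b + 1 / 2) b r +
        1 / 2 * √((1 - 2 * b) / (1 - 6 * b)) * (1 / √(1 - r ^ 2)))
      =O[𝓝[<] 1] (fun _ ↦ (1 : ℝ)) := by
  -- `D` is a quarter of the discriminant of `h` in `x`. Defining `u` from the product `u v`, not
  -- from `4bu = a - d`, keeps `b = 0` in the same argument.
  obtain ⟨D, hD⟩ : ∃ D : ℝ → ℝ, D = fun r ↦ b ^ 2 - 3 * b + 1 / 4 + 8 * b ^ 2 * r ^ 2 := ⟨_, rfl⟩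
  obtain ⟨d, hd⟩ : ∃ d : ℝ → ℝ, d = fun r ↦ √(D r) := ⟨_, rfl⟩
  obtain ⟨v, hv⟩ : ∃ v : ℝ → ℝ, v = fun r ↦ b + 1 / 2 + d r := ⟨_, rfl⟩
  obtain ⟨u, hu⟩ : ∃ u : ℝ → ℝ, u = fun r ↦ (1 - 2 * b * r ^ 2) / v r := ⟨_, rfl⟩
  obtain ⟨α, hα⟩ : ∃ α : ℝ → ℝ, α = fun r ↦ (1 - (b + 1 / 2) * u r) / (2 * d r) := ⟨_, rfl⟩
  -- `-G(r)` is the coefficient of `(1 - r²)^(-1/2)`. Differentiability at `1` gives `G(r) - G(1) =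
  -- O(1 - r)`, which absorbs that factor.
  obtain ⟨G, hG⟩ : ∃ G : ℝ → ℝ, G = fun r ↦
    α r * (√(v r ^ 2 - 16 * b ^ 2 * r ^ 2) / √(1 - 4 * b ^ 2 * r ^ 2)) := ⟨_, rfl⟩
  have hbabs : 4 * |b| < 1 - 2 * b := by
    rcases abs_cases b with ⟨h, _⟩ | ⟨h, _⟩ <;> rw [h] <;> linarith
  have hD1 : D 1 = (1 / 2 - 3 * b) ^ 2 := by rw [hD]; ring
  have hD1pos : 0 < D 1 := by rw [hD1]; exact pow_pos (by linarith) 2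
  have hd1 : d 1 = 1 / 2 - 3 * b := by
    rw [hd]; simp only; rw [hD1, Real.sqrt_sq (by linarith)]
  have hv1 : v 1 = 1 - 2 * b := by rw [hv]; simp only; rw [hd1]; ring
  have hu1 : u 1 = 1 := by
    rw [hu]; simp only; rw [hv1, one_pow, mul_one, div_self (by linarith)]
  have hw1 : v 1 ^ 2 - 16 * b ^ 2 * 1 ^ 2 = (1 - 6 * b) * (1 + 2 * b) := by rw [hv1]; ring
  have hp1 : 0 < 1 - 6 * b := by linarith
  have hp2 : 0 < 1 + 2 * b := by linarith
  have hp3 : 0 < 1 - 2 * b := by linarith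
  have hz1 : 1 - 4 * b ^ 2 * 1 ^ 2 = (1 - 2 * b) * (1 + 2 * b) := by ring
  have hDd : DifferentiableAt ℝ D 1 := by rw [hD]; fun_prop
  have hdd : DifferentiableAt ℝ d 1 := by
    rw [hd]
    exact hDd.sqrt hD1pos.ne'
  have hvd : DifferentiableAt ℝ v 1 := by
    rw [hv]
    exact hdd.const_add _
  have hud : DifferentiableAt ℝ u 1 := by
    rw [hu]
    exact DifferentiableAt.div (by fun_prop) hvd (by rw [hv1]; exact hp3.ne')
  have hαd : DifferentiableAt ℝ α 1 := by
    rw [hα]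
    exact DifferentiableAt.div (by fun_prop) (by fun_prop) (by rw [hd1]; linarith)
  have hGd : DifferentiableAt ℝ G 1 := by
    rw [hG]
    refine hαd.mul (DifferentiableAt.div ?_ ?_ ?_)
    · exact DifferentiableAt.sqrt (by fun_prop) (by rw [hw1]; positivity)
    · exact DifferentiableAt.sqrt (by fun_prop) (by rw [hz1]; positivity)
    · rw [hz1]; positivity
  have hG1 : G 1 = 1 / 2 * √((1 - 2 * b) / (1 - 6 * b)) := by
    simp only [hG, hα]
    rw [hw1, hz1, hu1, hd1, Real.sqrt_mul hp1.le, Real.sqrt_mul hp3.le, Real.sqrt_div hp3.le,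
      mul_div_mul_right _ _ (Real.sqrt_pos.2 hp2).ne']
    have e1 := Real.sq_sqrt hp1.le
    have e2 := Real.sq_sqrt hp3.le
    have h1 := Real.sqrt_pos.2 hp1
    have h2 := Real.sqrt_pos.2 hp3
    have e3 : (1 - (b + 1 / 2) * 1) / (2 * (1 / 2 - 3 * b)) =
        √(1 - 2 * b) ^ 2 / (2 * √(1 - 6 * b) ^ 2) := by
      rw [e1, e2, div_eq_div_iff (by linarith) (by linarith)]
      ring
    rw [e3]
    field_simp
  obtain ⟨C, hC⟩ := (hGd.isBigO_sub.mono (nhdsWithin_le_nhds (s := Set.Iio 1))).bound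
  have hvc := hvd.continuousAt.tendsto.mono_left (nhdsWithin_le_nhds (s := Set.Iio 1))
  have hDc := hDd.continuousAt.tendsto.mono_left (nhdsWithin_le_nhds (s := Set.Iio 1))
  have hαc := hαd.continuousAt.tendsto.mono_left (nhdsWithin_le_nhds (s := Set.Iio 1))
  -- Half the minimum over `[-1, 1]` of the second factor `4b x + v` at `r = 1`, where `v = 1 - 2b`.
  -- It is positive exactly for `-1/2 < b < 1/6`.
  set c₀ := (1 - 2 * b - 4 * |b|) / 2 with hc₀
  have hc₀pos : 0 < c₀ := by rw [hc₀]; linarith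
  have hvev : ∀ᶠ r in 𝓝[<] 1, 4 * |b| + c₀ < v r :=
    hvc.eventually_const_lt (by rw [hv1]; linarith)
  have hDev : ∀ᶠ r in 𝓝[<] 1, 0 < D r := hDc.eventually_const_lt hD1pos
  have hαev : ∀ᶠ r in 𝓝[<] 1, |α r| < |α 1| + 1 :=
    hαc.abs.eventually_lt_const (lt_add_one _)
  refine IsBigO.of_bound (1 + |C| + (b + 1 / 2 + 4 * |b| * (|α 1| + 1)) * (1 / c₀)) ?_
  filter_upwards [hC, hvev, hDev, hαev, Ioo_mem_nhdsLT (zero_lt_one (α := ℝ))]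
    with r hr1 hr2 hr3 hr4 hr01
  have hr0 := hr01.1
  have hr1' := hr01.2
  have hr2lt : r ^ 2 < 1 := pow_lt_one₀ hr0.le hr1' two_ne_zero
  have hrr : r ^ 2 ≤ r := by rw [sq]; exact mul_le_of_le_one_right hr0.le hr1'.le
  have hbr : b ^ 2 * r ^ 2 ≤ b ^ 2 := mul_le_of_le_one_right (sq_nonneg b) hr2lt.le
  have hδ : 0 < 1 - r ^ 2 := by linarith
  have hb4 : 4 * b ^ 2 < 1 := by
    linarith [mul_pos hp2 hp3, show (1 + 2 * b) * (1 - 2 * b) = 1 - 4 * b ^ 2 by ring]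
  have hz : 0 < 1 - 4 * b ^ 2 * r ^ 2 := by linarith
  have hvpos : 0 < v r := by linarith [abs_nonneg b]
  have hw : 0 < v r ^ 2 - 16 * b ^ 2 * r ^ 2 := by
    have h1 : 16 * b ^ 2 < v r ^ 2 := by
      have : 16 * b ^ 2 = (4 * |b|) ^ 2 := by rw [mul_pow, sq_abs]; norm_num
      rw [this]
      exact pow_lt_pow_left₀ (by linarith) (by positivity) two_ne_zero
    linarith
  have hdpos : 0 < d r := by rw [hd]; exact Real.sqrt_pos.2 hr3
  have hdsq : d r ^ 2 = b ^ 2 - 3 * b + 1 / 4 + 8 * b ^ 2 * r ^ 2 := by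
    simp only [hd]
    rw [Real.sq_sqrt hr3.le, hD]
  have huv : u r * v r = 1 - 2 * b * r ^ 2 := by
    simp only [hu]
    exact div_mul_cancel₀ _ hvpos.ne'
  have hvd' : v r = b + 1 / 2 + d r := by rw [hv]
  have hbu : 4 * b * u r = b + 1 / 2 - d r := by
    refine mul_right_cancel₀ hvpos.ne' ?_
    rw [mul_assoc, huv, hvd']
    linear_combination hdsq
  have hupos : 0 < u r := by
    rw [hu]
    refine div_pos ?_ hvpos
    rcases le_or_gt b 0 with h | h
    · have := mul_nonneg (neg_nonneg.2 h) (sq_nonneg r)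
      linarith
    · have := mul_lt_mul_of_pos_left hr2lt h
      linarith
  have hαd' : α r * (2 * d r) = 1 - (b + 1 / 2) * u r := by
    simp only [hα]
    exact div_mul_cancel₀ _ (by positivity)
  have hx4 : ∀ x ∈ Set.Icc (-r) r, c₀ ≤ 4 * b * x + v r := fun x hx ↦ by
    have h1 : |4 * b * x| ≤ 4 * |b| := by
      rw [abs_mul, abs_mul, abs_of_pos (by norm_num : (0 : ℝ) < 4)]
      exact mul_le_of_le_one_right (by positivity) ((abs_le.2 hx).trans hr1'.le)
    linarith [neg_abs_le (4 * b * x)]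
  obtain ⟨A, hA2, hex⟩ :=
    excess_eq_of_simple_root hr0 hr1' hc₀pos hvd' hbu huv hupos hαd' hx4 hw hz
  have hGr : G r = α r * (√(v r ^ 2 - 16 * b ^ 2 * r ^ 2) / √(1 - 4 * b ^ 2 * r ^ 2)) := by rw [hG]
  rw [hex, ← hG1, ← hGr]
  have e : 1 - G r / √(1 - r ^ 2) - (b + 1 / 2 - 4 * b * α r) * A + G 1 * (1 / √(1 - r ^ 2)) =
      1 + -((G r - G 1) / √(1 - r ^ 2)) + -((b + 1 / 2 - 4 * b * α r) * A) := by ring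
  rw [e, norm_one, mul_one]
  refine norm_add₃_le.trans ?_
  rw [norm_one, norm_neg, norm_neg, norm_mul, norm_div, Real.norm_of_nonneg (Real.sqrt_nonneg _),
    Real.norm_eq_abs A]
  have hroot : 1 - r ≤ √(1 - r ^ 2) := Real.le_sqrt_of_sq_le (by
    linarith [show (1 - r) ^ 2 = 1 - 2 * r + r ^ 2 by ring])
  have h1 : ‖G r - G 1‖ / √(1 - r ^ 2) ≤ |C| := by
    rw [div_le_iff₀ (Real.sqrt_pos.2 hδ)]
    refine hr1.trans ?_
    rw [Real.norm_eq_abs, abs_of_neg (by linarith), neg_sub]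
    exact mul_le_mul (le_abs_self C) hroot (by linarith) (abs_nonneg C)
  have h2 : ‖b + 1 / 2 - 4 * b * α r‖ ≤ b + 1 / 2 + 4 * |b| * (|α 1| + 1) := by
    refine (norm_sub_le _ _).trans ?_
    rw [Real.norm_of_nonneg (by linarith), norm_mul, norm_mul, Real.norm_eq_abs b,
      Real.norm_eq_abs (α r), Real.norm_of_nonneg (by norm_num : (0 : ℝ) ≤ 4)]
    gcongr
  have h3 : 0 ≤ b + 1 / 2 + 4 * |b| * (|α 1| + 1) := le_trans (norm_nonneg _) h2
  gcongr

/-- Asymptotics at the common endpoint of the segments. -/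
lemma isBigO_excess_corner :
    (fun r : ℝ ↦ excess 0 (-1 / 2) r + 1 / √2 * (1 / √(1 - r ^ 2)))
      =O[𝓝[<] 1] (fun _ ↦ (1 : ℝ)) := by
  refine IsBigO.of_bound 2 ?_
  filter_upwards [Ioo_mem_nhdsLT (zero_lt_one (α := ℝ))] with r hr
  have hr0 := hr.1
  have hr1 := hr.2
  have hr2 : r ^ 2 < 1 := by nlinarith
  have hδ : 0 < 1 - r ^ 2 := by linarith
  have hδ' : 0 < 1 + r ^ 2 := by positivity
  -- Here `h = 2 (p² - x²)`; the two factors have equal averages by the symmetry `z ↦ -z`.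
  set p := √((1 + r ^ 2) / 2) with hp
  have hppos : 0 < p := by positivity
  have hpsq : p ^ 2 = (1 + r ^ 2) / 2 := Real.sq_sqrt (by positivity)
  set s := √((1 - r ^ 2) / 2) with hs
  have hspos : 0 < s := by positivity
  have hssq : s ^ 2 = (1 - r ^ 2) / 2 := Real.sq_sqrt (by positivity)
  have havg := circleAverage_inv_add_re_real hr0 hppos hspos (by rw [hssq, hpsq]; ring)
  have hrp : r < p := lt_of_pow_lt_pow_left₀ 2 hppos.le (by rw [hpsq]; linarith)
  have havg' : Real.circleAverage (fun z ↦ 1 / (p - z.re)) 0 r = 1 / s := by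
    rw [← havg, ← Real.circleAverage_neg_radius, Real.circleAverage_def, Real.circleAverage_def]
    congr 2
    ext θ
    have e : circleMap 0 (-r) θ = -circleMap 0 r θ := by simp [circleMap]
    rw [e, Complex.neg_re, sub_neg_eq_add]
  have i1 : CircleIntegrable (fun z ↦ 1 / (p + z.re)) 0 r :=
    circleIntegrable_comp_re (F := fun x ↦ 1 / (p + x)) hr0.le fun x hx ↦
      ContinuousAt.div (by fun_prop) (by fun_prop) (by linarith [hx.1])
  have i2 : CircleIntegrable (fun z ↦ 1 / (p - z.re)) 0 r :=
    circleIntegrable_comp_re (F := fun x ↦ 1 / (p - x)) hr0.le fun x hx ↦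
      ContinuousAt.div (by fun_prop) (by fun_prop) (by linarith [hx.2])
  have hcongr : Set.EqOn (fun z : ℂ ↦ 1 - (1 + 0 * z.re) / harm 0 (-1 / 2) z)
      (fun z ↦ 1 + -(1 / (4 * p)) * (1 / (p + z.re)) + -(1 / (4 * p)) * (1 / (p - z.re)))
      (sphere 0 |r|) := by
    intro z hz
    rw [abs_of_pos hr0, mem_sphere_zero_iff_norm] at hz
    have hx := abs_le.1 ((Complex.abs_re_le_norm z).trans hz.le)
    have n1 : p + z.re ≠ 0 := by linarith [hx.1]
    have n2 : p - z.re ≠ 0 := by linarith [hx.2]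
    have hh : harm 0 (-1 / 2) z = 2 * ((p + z.re) * (p - z.re)) := by
      rw [harm_of_norm_eq _ _ hz]
      linear_combination -2 * hpsq
    simp only [hh]
    field_simp
    ring
  have hex : excess 0 (-1 / 2) r = 1 - 1 / (4 * p) * (1 / s + 1 / s) := by
    rw [excess, Real.circleAverage_congr_sphere hcongr,
      circleAverage_const_add_mul_add_mul i1 i2, havg, havg']
    ring
  have h2 : √(1 - r ^ 2) = √2 * s := by
    rw [hs, ← Real.sqrt_mul (by norm_num)]
    congr 1
    ring
  have h3 : √2 * √2 = (2 : ℝ) := Real.mul_self_sqrt (by norm_num)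
  have h4 : (0 : ℝ) < √2 := by positivity
  have e1 : 1 / √2 * (1 / √(1 - r ^ 2)) = 1 / (2 * s) := by
    rw [h2, div_mul_div_comm, ← mul_assoc, h3, one_mul]
  have hp1 : p < 1 := by
    rw [hp, Real.sqrt_lt' one_pos]
    linarith
  have hp2 : 1 / 2 ≤ p := Real.le_sqrt_of_sq_le (by nlinarith)
  rw [hex, e1]
  have e2 : 1 - 1 / (4 * p) * (1 / s + 1 / s) + 1 / (2 * s) = 1 - (1 - p) / (2 * p * s) := by
    field_simp
    ring
  have e3 : 1 - p ≤ s := by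
    refine Real.le_sqrt_of_sq_le ?_
    nlinarith
  have e4 : 0 ≤ (1 - p) / (2 * p * s) := div_nonneg (by linarith) (by positivity)
  have e5 : (1 - p) / (2 * p * s) ≤ 1 := by
    rw [div_le_one (by positivity)]
    nlinarith
  rw [e2, Real.norm_eq_abs, abs_le, norm_one]
  constructor <;> linarith

end TwoDependentGAF

/-! ### Assembly -/

namespace TwoDependentGAF

/-- The asymptotics of the expected number of zeros are those of the excess. -/
lemma IsStationaryComplexGaussian.isBigO_expectedZeroCount {Ω : Type*} [MeasurableSpace Ω]
    {P : Measure Ω} [IsProbabilityMeasure P] {ξ : ℤ → Ω → ℂ} {a b : ℝ} (hab : (a, b) ∈ region)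
    (h : IsStationaryComplexGaussian P ξ (gamma a b)) {g e : ℝ → ℝ}
    (hg : (fun r ↦ excess a b r + g r) =O[𝓝[<] 1] e) :
    (fun r : ℝ ↦ (expectedZeroCount P ξ r).toReal - (r ^ 2 / (1 - r ^ 2) - g r))
      =O[𝓝[<] 1] e := by
  refine EventuallyEq.trans_isBigO ?_ hg
  filter_upwards [Ioo_mem_nhdsLT (zero_lt_one' ℝ)] with r hr
  rw [(h.expectedZeroCount_eq hab hr.1 hr.2).2]
  ring

end TwoDependentGAF

theorem theorem1p1 (a b : ℝ) (hab : (a, b) ∈ TwoDependentGAF.region) :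
    -- the constant `C`, for the interior, depends on `(a, b)` only
    ∃ C : ℝ,
      ((a, b) ∈ interior TwoDependentGAF.region → 0 ≤ C ∧ (0 < C ↔ (a, b) ≠ (0, 0))) ∧
      ∀ {Ω : Type*} [MeasurableSpace Ω] (P : Measure Ω) [IsProbabilityMeasure P] (ξ : ℤ → Ω → ℂ),
        TwoDependentGAF.IsStationaryComplexGaussian P ξ (TwoDependentGAF.gamma a b) →
        -- the expected number of zeros is finite
        (∀ r : ℝ, 0 < r → r < 1 → TwoDependentGAF.expectedZeroCount P ξ r ≠ ⊤) ∧
        -- the elliptic arc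
        (a ^ 2 / 8 + (b - 1 / 4) ^ 2 = 1 / 16 → 1 / 6 < b → b ≤ 1 / 2 →
          (fun r : ℝ ↦ (TwoDependentGAF.expectedZeroCount P ξ r).toReal -
              (r ^ 2 / (1 - r ^ 2) -
                √(2 * b / (6 * b - 1)) * (1 / (1 - r ^ 2) ^ (1 / 2 : ℝ))))
            =O[𝓝[<] 1] (fun _ ↦ (1 : ℝ))) ∧
        -- the line segments
        (b = |a| - 1 / 2 → -1 / 2 < b → b < 1 / 6 →
          (fun r : ℝ ↦ (TwoDependentGAF.expectedZeroCount P ξ r).toReal -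
              (r ^ 2 / (1 - r ^ 2) -
                1 / 2 * √((1 - 2 * b) / (1 - 6 * b)) * (1 / (1 - r ^ 2) ^ (1 / 2 : ℝ))))
            =O[𝓝[<] 1] (fun _ ↦ (1 : ℝ))) ∧
        -- the common endpoint of the two segments
        ((a, b) = (0, -1 / 2) →
          (fun r : ℝ ↦ (TwoDependentGAF.expectedZeroCount P ξ r).toReal -
              (r ^ 2 / (1 - r ^ 2) -
                1 / √2 * (1 / (1 - r ^ 2) ^ (1 / 2 : ℝ))))
            =O[𝓝[<] 1] (fun _ ↦ (1 : ℝ))) ∧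
        -- the points where the arc meets the segments
        ((a, b) = (2 / 3, 1 / 6) ∨ (a, b) = (-2 / 3, 1 / 6) →
          (fun r : ℝ ↦ (TwoDependentGAF.expectedZeroCount P ξ r).toReal -
              (r ^ 2 / (1 - r ^ 2) -
                1 / (2 : ℝ) ^ (5 / 4 : ℝ) * (1 / (1 - r ^ 2) ^ (3 / 4 : ℝ))))
            =O[𝓝[<] 1] (fun r ↦ 1 / (1 - r ^ 2) ^ (1 / 4 : ℝ))) ∧
        -- the interior
        ((a, b) ∈ interior TwoDependentGAF.region →
          (fun r : ℝ ↦ (TwoDependentGAF.expectedZeroCount P ξ r).toReal -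
              (r ^ 2 / (1 - r ^ 2) - C))
            =O[𝓝[<] 1] (fun r ↦ 1 - r ^ 2)) := by
  -- The excess depends on `(a, b)` alone, so `C` is chosen before the probability space.
  refine ⟨-TwoDependentGAF.excess a b 1, fun hint ↦ ?_, fun {Ω} _ P _ ξ h ↦ ⟨?_, ?_, ?_, ?_, ?_, ?_⟩⟩
  · by_cases h0 : (a, b) = (0, 0)
    · obtain ⟨rfl, rfl⟩ := Prod.mk.injEq .. ▸ h0
      simp [TwoDependentGAF.excess_zero_zero]
    · have := TwoDependentGAF.excess_one_neg hint h0
      exact ⟨by linarith, fun _ ↦ h0, fun _ ↦ by linarith⟩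
  · intro r hr0 hr
    rw [(h.expectedZeroCount_eq hab hr0 hr).1]
    exact ENNReal.ofReal_ne_top
  · intro harc hb _
    refine h.isBigO_expectedZeroCount hab ?_
    simpa only [Real.sqrt_eq_rpow] using
      TwoDependentGAF.isBigO_excess_arc (a := a) (by linarith) hb
  · intro hseg hb1 hb2
    refine h.isBigO_expectedZeroCount hab ?_
    -- Evenness in `a` reduces both segments to `a = b + 1/2`.
    have ha : TwoDependentGAF.excess a b = TwoDependentGAF.excess (b + 1 / 2) b := by
      ext r
      rcases abs_choice a with ha | ha
      · rw [show b + 1 / 2 = a by linarith]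
      · rw [show b + 1 / 2 = -a by linarith, TwoDependentGAF.excess_neg_left]
    rw [ha]
    simpa only [Real.sqrt_eq_rpow] using TwoDependentGAF.isBigO_excess_segment hb1 hb2
  · intro hc
    obtain ⟨rfl, rfl⟩ := Prod.mk.injEq .. ▸ hc
    refine h.isBigO_expectedZeroCount hab ?_
    simpa only [Real.sqrt_eq_rpow] using TwoDependentGAF.isBigO_excess_corner
  · intro hc
    refine h.isBigO_expectedZeroCount hab ?_
    rcases hc with hc | hc <;> obtain ⟨rfl, rfl⟩ := Prod.mk.injEq .. ▸ hc
    · exact TwoDependentGAF.isBigO_excess_cusp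
    · simpa only [neg_div, TwoDependentGAF.excess_neg_left] using
        TwoDependentGAF.isBigO_excess_cusp
  · intro hint
    refine h.isBigO_expectedZeroCount hab ?_
    simpa only [sub_eq_add_neg] using
      TwoDependentGAF.isBigO_excess_sub_of_mem_interior hint
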